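/- Let $S$ be a countable set and let $\Gamma$ be a Coxeter graph with vertex set $S$ and Coxeter matrix $M=(m_{s,t})_{s,t\in S}$; that is, $M$ is symmetric with entries in $\mathbb{N}\cup\{\infty\}$, $m_{s,s}=1$ for all $s\in S$, and $m_{s,t}=m_{t,s}\ge 2$ for all $s\ne t$ in $S$. For elements $a,b$ of a group and an integer $m\ge 1$, let $\mathrm{Prod}_R(b,a,m)=\cdots aba$ denote the alternating product with $m$ factors whose last factor is $a$. Let $\mathrm{VA}[\Gamma]$ be the virtual Artin group of $\Gamma$, i.e. the group with generators $\sigma_s,\tau_s$ ($s\in S$) and relations - $\mathrm{Prod}_R(\sigma_t,\sigma_s,m_{s,t})=\mathrm{Prod}_R(\sigma_s,\sigma_t,m_{s,t})$ for $s,t\in S$, $s\neq t$, $m_{s,t}\neq\infty$; - $\mathrm{Prod}_R(\tau_t,\tau_s,m_{s,t})=\mathrm{Prod}_R(\tau_s,\tau_t,m_{s,t})$ for $s,t\in S$, $s\neq t$, $m_{s,t}\neq\infty$, and $\tau_s^2=1$ for $s\in S$; - $\mathrm{Prod}_R(\tau_s,\tau_t,m_{s,t}-1)\,\sigma_s=\sigma_r\,\mathrm{Prod}_R(\tau_s,\tau_t,m_{s,t}-1)$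 for $s,t\in S$, $s\neq t$, $m_{s,t}\neq\infty$, where $r=s$ if $m_{s,t}$ is even and $r=t$ if $m_{s,t}$ is odd. Then the center of $\mathrm{VA}[\Gamma]$ is trivial: $Z(\mathrm{VA}[\Gamma])=\{1\}$. -/

import Mathlib

/-- `prodR b a m` is the alternating product `⋯ a b a` with `m` factors, whose last factor is
`a` (for `m ≥ 1`). -/
def prodR {G : Type*} [Monoid G] : G → G → ℕ → G
  | _, _, 0 => 1
  | b, a, m + 1 => prodR a b m * a

/-- The generating set of a virtual Artin group: the disjoint union of two copies
`{σ_s | s ∈ S}` and `{τ_s | s ∈ S}` of the vertex set `S`. -/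
inductive VAGen (S : Type*) where
  | sigma (s : S) : VAGen S
  | tau (s : S) : VAGen S

/-- The generator `σ_s` of the free group on `VAGen S`. -/
def freeSigma {S : Type*} (s : S) : FreeGroup (VAGen S) := FreeGroup.of (VAGen.sigma s)

/-- The generator `τ_s` of the free group on `VAGen S`. -/
def freeTau {S : Type*} (s : S) : FreeGroup (VAGen S) := FreeGroup.of (VAGen.tau s)

/-- The defining relations `lhs = rhs` of the virtual Artin group of a Coxeter matrix `M`.
In Mathlib's `CoxeterMatrix`, the entry `0` stands for `∞`. -/
inductive VARel {S : Type*} (M : CoxeterMatrix S) :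
    FreeGroup (VAGen S) → FreeGroup (VAGen S) → Prop
  /-- The Artin relations between the `σ_s`. -/
  | artin (s t : S) (hst : s ≠ t) (hfin : M s t ≠ 0) :
      VARel M (prodR (freeSigma t) (freeSigma s) (M s t))
        (prodR (freeSigma s) (freeSigma t) (M s t))
  /-- The braid relations between the `τ_s`. -/
  | coxeter (s t : S) (hst : s ≠ t) (hfin : M s t ≠ 0) :
      VARel M (prodR (freeTau t) (freeTau s) (M s t))
        (prodR (freeTau s) (freeTau t) (M s t))
  /-- The `τ_s` are involutions. -/
  | involution (s : S) : VARel M (freeTau s ^ 2) 1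
  /-- The mixed relations, when `m_{s,t}` is even. -/
  | mixed_even (s t : S) (hst : s ≠ t) (hfin : M s t ≠ 0) (heven : Even (M s t)) :
      VARel M (prodR (freeTau s) (freeTau t) (M s t - 1) * freeSigma s)
        (freeSigma s * prodR (freeTau s) (freeTau t) (M s t - 1))
  /-- The mixed relations, when `m_{s,t}` is odd. -/
  | mixed_odd (s t : S) (hst : s ≠ t) (hfin : M s t ≠ 0) (hodd : Odd (M s t)) :
      VARel M (prodR (freeTau s) (freeTau t) (M s t - 1) * freeSigma s)
        (freeSigma t * prodR (freeTau s) (freeTau t) (M s t - 1))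

/-- The virtual Artin group `VA[Γ]` of the Coxeter graph `Γ` with Coxeter matrix `M`, given by
its presentation. -/
abbrev VirtualArtinGroup {S : Type*} (M : CoxeterMatrix S) : Type _ :=
  PresentedGroup {g : FreeGroup (VAGen S) | ∃ x y, VARel M x y ∧ g = x * y⁻¹}

/-!
The group `VA[Γ]` is a semidirect product of an Artin group `A` by the Coxeter group `W` of `Γ`
(`VirtualArtinGroup.semidirectEquiv`). The generators of `A` correspond to the roots of `W`, the
root `w α_s` to `w σ_s w⁻¹`, and opposite roots have label `∞`. Let `(k, w)` be central. Then `w` is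
central in `W`, so it maps each root `β` to `±β`, and conjugation by `k` fixes or exchanges the
generators for `β` and `-β`. Since their label is `∞`, the group `A` is the amalgamated product
of the subgroups generated without the one and without the other, and reduced words show that `k`
lies in the amalgamated subgroup (`ArtinGroup.mem_parabolic_of_conj`). So `k` can be expressed
without the generator for `β`, for every `β`. As intersections of standard parabolic subgroups are
standard parabolic (`ArtinGroup.mem_parabolic_inter`), this forces `k = 1`. Then `w` fixes all
roots, so `w = 1`.

Two facts about Artin and Coxeter groups carry this. For the intersection of parabolic subgroups,
the action of the Coxeter group on the cosets of `W_X` is lifted to an action of the Artin group on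
pairs consisting of a coset and an element of the Artin group (`ArtinGroup.moveHom`). The braid
relations are checked on each orbit of a dihedral parabolic subgroup, which fixes the coset, moves
it along a path, or moves it freely. For the semidirect product, if `w α_s = α_t`, then
`w σ_s w⁻¹ = σ_t` follows from the mixed relations (`VirtualArtinGroup.ofCoxeter_conj_sigma`). Both rest on the theory of roots of Coxeter groups,
which are modelled by reflections with a sign (`CoxeterSystem.rootPerm`), as in Bourbaki. The
geometric representation only serves to show that `s t` has order exactly `m_{s,t}`, and that a
simple reflection lies in `W_X` only if its index lies in `X`.
-/

/-! ### The geometric representation of a Coxeter group -/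

namespace CoxeterMatrix

open Polynomial.Chebyshev Module

variable {B : Type*} (M : CoxeterMatrix B)

/-- The coroot of the simple root `single s 1` in the geometric representation of the Coxeter
group on `B →₀ ℝ`: the functional `v ↦ 2 ⟨e_s, v⟩`, where `⟨e_s, e_t⟩ = -cos (π / m_{s,t})`.
Since `0` encodes the infinite label, `cos (π / 0) = cos 0 = 1` gives the desired value `-1`. -/
noncomputable def coroot (s : B) : Dual ℝ (B →₀ ℝ) :=
  Finsupp.linearCombination ℝ fun t => -2 * Real.cos (Real.pi / M s t)

lemma coroot_single (s t : B) :
    M.coroot s (Finsupp.single t 1) = -2 * Real.cos (Real.pi / M s t) := by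
  simp [coroot]

lemma coroot_self (s : B) : M.coroot s (Finsupp.single s 1) = 2 := by
  simp [coroot_single]

/-- The reflection by which a simple generator acts in the geometric representation. -/
noncomputable def geomReflection (s : B) : (B →₀ ℝ) ≃ₗ[ℝ] (B →₀ ℝ) :=
  reflection (M.coroot_self s)

lemma coroot_mul_coroot (s t : B) :
    M.coroot s (Finsupp.single t 1) * M.coroot t (Finsupp.single s 1) - 2 =
      2 * Real.cos (2 * Real.pi / M s t) := by
  rw [coroot_single, coroot_single, M.symmetric t s, mul_div_assoc, Real.cos_two_mul]
  ring

lemma three_le_of_ne {s t : B} (hst : s ≠ t) (h0 : M s t ≠ 0) (h2 : M s t ≠ 2) : 3 ≤ M s t := by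
  have := M.off_diagonal s t hst
  omega

lemma sin_two_pi_div_pos {m : ℕ} (hm : 3 ≤ m) : 0 < Real.sin (2 * Real.pi / m) := by
  have h3 : (3 : ℝ) ≤ m := by exact_mod_cast hm
  apply Real.sin_pos_of_pos_of_lt_pi
  · have := Real.pi_pos
    positivity
  · rw [div_lt_iff₀ (by linarith)]
    nlinarith [Real.pi_pos]

lemma isLiftable_geomReflection : M.IsLiftable M.geomReflection := by
  intro s t
  rcases eq_or_ne s t with rfl | hst
  · ext1 v
    simp [geomReflection, involutive_reflection (M.coroot_self s) v]
  by_cases h0 : M s t = 0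
  · simp [h0]
  have key := fun z => reflection_mul_reflection_pow_apply (M.coroot_self s) (M.coroot_self t)
    (M s t) z _ (M.coroot_mul_coroot s t).symm
  apply LinearEquiv.ext
  intro z
  rw [geomReflection, geomReflection, key z]
  by_cases h2 : M s t = 2
  · simp only [h2, coroot_single, M.symmetric t s]
    norm_num
    abel
  have h3 := M.three_le_of_ne hst h0 h2
  generalize M s t = m at *
  have hsin := (sin_two_pi_div_pos h3).ne'
  have hS : ∀ n : ℤ, _ := fun n => S_two_mul_real_cos (2 * Real.pi / m) n
  have hm0 : (m : ℝ) ≠ 0 := by exact_mod_cast h0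
  obtain ⟨k, rfl | rfl⟩ := m.even_or_odd'
  · have e1 : (((2 * k : ℕ) : ℤ) - 2) / 2 = k - 1 := by omega
    have e2 : (((2 * k : ℕ) : ℤ) - 1) / 2 = k - 1 := by omega
    have hz : (S ℝ (k - 1 : ℤ)).eval (2 * Real.cos (2 * Real.pi / (2 * k : ℕ))) = 0 := by
      refine (mul_eq_zero.1 ((hS _).trans ?_)).resolve_right hsin
      have : (((k - 1 : ℤ) : ℝ) + 1) * (2 * Real.pi / (2 * k : ℕ)) = Real.pi := by
        have hk0 : (k : ℝ) ≠ 0 := by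
          rintro hk0
          simp [hk0] at hm0
        push_cast
        field_simp
        ring
      rw [this, Real.sin_pi]
    rw [e1, e2, hz]
    simp
  · have e1 : (((2 * k + 1 : ℕ) : ℤ) - 2) / 2 = k - 1 := by omega
    have e2 : (((2 * k + 1 : ℕ) : ℤ) - 1) / 2 = k := by omega
    have e3 : (((2 * k + 1 : ℕ) : ℤ) - 3) / 2 = k - 1 := by omega
    have e4 : (((2 * k + 1 : ℕ) : ℤ)) / 2 = k := by omega
    have hz : (S ℝ (k : ℤ)).eval (2 * Real.cos (2 * Real.pi / (2 * k + 1 : ℕ))) +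
        (S ℝ (k - 1 : ℤ)).eval (2 * Real.cos (2 * Real.pi / (2 * k + 1 : ℕ))) = 0 := by
      refine (mul_eq_zero.1 ?_).resolve_right hsin
      have : (((k : ℤ) : ℝ) + 1) * (2 * Real.pi / (2 * k + 1 : ℕ)) =
          2 * Real.pi - (((k - 1 : ℤ) : ℝ) + 1) * (2 * Real.pi / (2 * k + 1 : ℕ)) := by
        push_cast at hm0 ⊢
        field_simp
        ring
      rw [add_mul, hS, hS, this, Real.sin_two_pi_sub, neg_add_cancel]
    rw [e1, e2, e3, e4, hz]
    simp

lemma dvd_of_geomReflection_mul_pow {s t : B} (hst : s ≠ t) {n : ℕ}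
    (h : (M.geomReflection s * M.geomReflection t) ^ n = 1) : M s t ∣ n := by
  have key := reflection_mul_reflection_pow_apply_self (M.coroot_self s) (M.coroot_self t)
    n _ (M.coroot_mul_coroot s t).symm
  rw [geomReflection, geomReflection] at h
  rw [h, LinearEquiv.coe_one, id] at key
  have hs := DFunLike.congr_fun key s
  have ht := DFunLike.congr_fun key t
  simp only [Finsupp.add_apply, Finsupp.smul_apply, Finsupp.single_eq_same, smul_eq_mul,
    Finsupp.single_eq_of_ne hst, Finsupp.single_eq_of_ne hst.symm, mul_one, mul_zero, add_zero,
    zero_add, coroot_single, M.symmetric t s] at hs ht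
  by_cases h0 : M s t = 0
  · simp only [h0, Nat.cast_zero, div_zero, Real.cos_zero, mul_one, S_eval_two] at ht
    push_cast at ht
    have hn : (n : ℝ) = 0 := by linarith
    rw [Nat.cast_eq_zero.1 hn]
    exact dvd_zero _
  by_cases h2 : M s t = 2
  · have e : 2 * Real.cos (2 * Real.pi / (2 : ℕ)) = -2 := by
      norm_num
    rw [h2, e, S_eval_neg_two, S_eval_neg_two, Int.negOnePow_sub, Int.negOnePow_one] at hs
    rw [h2]
    rcases n.even_or_odd with hn | hn
    · exact hn.two_dvd
    · rw [Int.negOnePow_odd _ (by exact_mod_cast hn)] at hs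
      push_cast at hs
      norm_num at hs
  have h3 := M.three_le_of_ne hst h0 h2
  generalize M s t = m at *
  have hsin := (sin_two_pi_div_pos h3).ne'
  have hm0 : (m : ℝ) ≠ 0 := by exact_mod_cast h0
  have hcos : Real.cos (Real.pi / m) ≠ 0 := by
    refine fun hc => hsin ?_
    rw [mul_div_assoc, Real.sin_two_mul, hc, mul_zero]
  have hz := (mul_eq_zero.1 ht.symm).resolve_right (by simpa using hcos)
  have h1 := S_two_mul_real_cos (2 * Real.pi / m) n
  have h1' := S_two_mul_real_cos (2 * Real.pi / m) (n - 1)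
  rw [hz] at h1' hs
  rw [add_zero] at hs
  rw [← hs, one_mul, add_mul, one_mul, Real.sin_add] at h1
  push_cast at h1 h1'
  rw [sub_add_cancel, zero_mul] at h1'
  rw [← h1', zero_mul, zero_add] at h1
  have hc : Real.cos (n * (2 * Real.pi / m)) = 1 := mul_right_cancel₀ hsin (by rw [one_mul, ← h1])
  obtain ⟨k, hk⟩ := (Real.cos_eq_one_iff _).1 hc
  have hk' : (k : ℝ) * m = n := by
    have := Real.pi_pos.ne'
    field_simp at hk
    linarith
  have hk'' : k * m = n := by exact_mod_cast hk'
  exact Int.natCast_dvd_natCast.1 ⟨k, by rw [← hk'', mul_comm]⟩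

end CoxeterMatrix

namespace CoxeterSystem

variable {B W : Type*} [Group W] {M : CoxeterMatrix B} (cs : CoxeterSystem M W)

/-- The product of two simple reflections has order exactly `m_{s,t}`, because it has that order in
the geometric representation. -/
theorem simple_mul_simple_pow_eq_one_iff {s t : B} (hst : s ≠ t) (n : ℕ) :
    (cs.simple s * cs.simple t) ^ n = 1 ↔ M s t ∣ n := by
  constructor
  · intro h
    have h' := congrArg (cs.lift ⟨M.geomReflection, M.isLiftable_geomReflection⟩) h
    rw [map_pow, map_mul, map_one, cs.lift_apply_simple, cs.lift_apply_simple] at h'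
    exact M.dvd_of_geomReflection_mul_pow hst h'
  · rintro ⟨k, rfl⟩
    rw [pow_mul, cs.simple_mul_simple_pow, one_pow]

theorem orderOf_simple_mul_simple {s t : B} (hst : s ≠ t) :
    orderOf (cs.simple s * cs.simple t) = M s t :=
  Nat.dvd_antisymm (orderOf_dvd_iff_pow_eq_one.2 (cs.simple_mul_simple_pow s t))
    ((cs.simple_mul_simple_pow_eq_one_iff hst _).1 (pow_orderOf_eq_one _))

theorem simple_injective : Function.Injective cs.simple := by
  intro s t h
  by_contra hst
  have h1 := cs.simple_mul_simple_pow_eq_one_iff hst 1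
  rw [h, pow_one, cs.simple_mul_simple_self] at h1
  exact M.off_diagonal s t hst (Nat.dvd_one.1 (h1.1 rfl))

/-- The standard parabolic subgroup of a Coxeter group generated by the simple reflections with
index in `X`. -/
def parabolic (X : Set B) : Subgroup W := Subgroup.closure (cs.simple '' X)

lemma simple_mem_parabolic {X : Set B} {s : B} (hs : s ∈ X) : cs.simple s ∈ cs.parabolic X :=
  Subgroup.subset_closure ⟨s, hs, rfl⟩

/-- In the geometric representation, the reflections with index in `X` do not change the
coordinates outside `X`, whereas `s` negates the coordinate at `s` of its own root. -/
theorem simple_mem_parabolic_iff {X : Set B} {s : B} :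
    cs.simple s ∈ cs.parabolic X ↔ s ∈ X := by
  refine ⟨fun h => ?_, cs.simple_mem_parabolic⟩
  by_contra hs
  let ρ := cs.lift ⟨M.geomReflection, M.isLiftable_geomReflection⟩
  have hρ : ∀ i, ρ (cs.simple i) = M.geomReflection i := fun i => cs.lift_apply_simple _ i
  have key : ∀ w ∈ cs.parabolic X, ∀ v : B →₀ ℝ, ρ w v s = v s := by
    intro w hw
    induction hw using Subgroup.closure_induction with
    | mem x hx =>
      obtain ⟨i, hi, rfl⟩ := hx
      intro v
      have his : s ≠ i := fun e => hs (e ▸ hi)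
      simp [hρ, CoxeterMatrix.geomReflection, Module.reflection_apply, his]
    | one => simp
    | mul x y _ _ hx hy =>
      intro v
      rw [map_mul, LinearEquiv.mul_apply, hx, hy]
    | inv x _ hx =>
      intro v
      rw [← hx, ← LinearEquiv.mul_apply, ← map_mul, mul_inv_cancel, map_one, LinearEquiv.coe_one,
        id]
  have h1 := key _ h (Finsupp.single s 1)
  rw [hρ, CoxeterMatrix.geomReflection, Module.reflection_apply_self] at h1
  norm_num at h1

end CoxeterSystem

/-! ### Alternating products -/

lemma prodR_succ {G : Type*} [Monoid G] (b a : G) (n : ℕ) :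
    prodR b a (n + 1) = prodR a b n * a := rfl

lemma prodR_succ' {G : Type*} [Monoid G] (b a : G) (n : ℕ) :
    prodR b a (n + 1) = (if Even n then a else b) * prodR b a n := by
  induction n generalizing a b with
  | zero => simp [prodR]
  | succ n ih =>
    rw [prodR_succ, ih, mul_assoc, prodR_succ]
    simp [Nat.even_add_one, -Nat.not_even_iff_odd]

lemma map_prodR {G H F : Type*} [Monoid G] [Monoid H] [FunLike F G H] [MonoidHomClass F G H]
    (f : F) (b a : G) (n : ℕ) : f (prodR b a n) = prodR (f b) (f a) n := by
  induction n generalizing a b with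
  | zero => simp [prodR]
  | succ n ih => rw [prodR_succ, map_mul, ih, prodR_succ]

lemma prodR_mem {G S : Type*} [Monoid G] [SetLike S G] [SubmonoidClass S G] {H : S} {b a : G}
    (hb : b ∈ H) (ha : a ∈ H) (n : ℕ) : prodR b a n ∈ H := by
  induction n generalizing a b with
  | zero => exact one_mem H
  | succ n ih => exact mul_mem (ih ha hb) ha

/-! ### Roots as signed reflections -/

namespace CoxeterSystem

open scoped Classical in
/-- The action of an involution `s` on signed group elements: `(t, ε)` is sent to `(s t s, ε)`,
except that the sign changes when `t = s`. -/
noncomputable def signedConj {W : Type*} [Group W] (s : W) (hs : s * s = 1) :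
    Equiv.Perm (W × ℤˣ) :=
  Function.Involutive.toPerm (fun x => (s * x.1 * s, if x.1 = s then -x.2 else x.2)) <| by
    rintro ⟨t, ε⟩
    have h : s * (s * t * s) * s = t := by
      rw [mul_assoc, mul_assoc, mul_assoc, hs, mul_one, ← mul_assoc, hs, one_mul]
    have h' : s * t * s = s ↔ t = s := by
      rw [mul_assoc, mul_eq_left, ← mul_left_inj s, mul_assoc, hs, mul_one, one_mul]
    simp only [h, h']
    split_ifs <;> simp

open scoped Classical in
lemma signedConj_apply {W : Type*} [Group W] (s : W) (hs : s * s = 1) (x : W × ℤˣ) :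
    signedConj s hs x = (s * x.1 * s, if x.1 = s then -x.2 else x.2) := rfl

variable {B W : Type*} [Group W] {M : CoxeterMatrix B} (cs : CoxeterSystem M W)

open scoped Classical in
lemma signedConj_mul_pow {s t : W} (hs : s * s = 1) (ht : t * t = 1) (n : ℕ) (x : W × ℤˣ) :
    ((signedConj s hs * signedConj t ht) ^ n) x = ((s * t) ^ n * x.1 * ((s * t) ^ n)⁻¹,
      x.2 * ∏ j ∈ Finset.range (2 * n), if x.1 = t * (s * t) ^ j then -1 else 1) := by
  have hs' : s⁻¹ = s := inv_eq_of_mul_eq_one_left hs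
  have ht' : t⁻¹ = t := inv_eq_of_mul_eq_one_left ht
  have hconj : ∀ n : ℕ, ((s * t) ^ n)⁻¹ * t = t * (s * t) ^ n := by
    intro n
    induction n with
    | zero => simp
    | succ n ih =>
      rw [pow_succ, mul_inv_rev, mul_assoc, ih, ← mul_assoc, ← mul_assoc, mul_inv_rev, hs', ht',
        mul_assoc t s t, mul_assoc t, mul_assoc t, ← pow_succ', ← pow_succ]
  induction n with
  | zero => simp
  | succ n ih =>
    rw [pow_succ', Equiv.Perm.mul_apply, ih, mul_add, mul_one, Finset.prod_range_succ,
      Finset.prod_range_succ, ← mul_assoc, ← mul_assoc]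
    generalize x.2 * ∏ j ∈ Finset.range (2 * n), (if x.1 = t * (s * t) ^ j then -1 else 1) = ε
    have e1 : (s * t) ^ n * x.1 * ((s * t) ^ n)⁻¹ = t ↔ x.1 = t * (s * t) ^ (2 * n) := by
      rw [mul_inv_eq_iff_eq_mul, ← eq_inv_mul_iff_mul_eq, ← mul_assoc, hconj, mul_assoc,
        ← pow_add, two_mul]
    have e2 : t * ((s * t) ^ n * x.1 * ((s * t) ^ n)⁻¹) * t = s ↔
        x.1 = t * (s * t) ^ (2 * n + 1) := by
      rw [← eq_mul_inv_iff_mul_eq, ← eq_inv_mul_iff_mul_eq, mul_inv_eq_iff_eq_mul,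
        ← eq_inv_mul_iff_mul_eq, ht', ← mul_assoc, ← mul_assoc, hconj, mul_assoc t, mul_assoc t,
        ← pow_succ, ← pow_add, two_mul, add_right_comm]
    simp only [Equiv.Perm.mul_apply, signedConj_apply, e1, e2]
    ext1
    · simp only [pow_succ', mul_inv_rev, hs', ht', mul_assoc]
    · split_ifs <;> simp

/-- The exponents in `signedConj_mul_pow` range over two periods of `(s t) ^ j`, so that every sign
change occurs twice. -/
lemma isLiftable_signedConj :
    M.IsLiftable fun s => signedConj (cs.simple s) (cs.simple_mul_simple_self s) := by
  classical
  intro s t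
  ext1 x
  rw [signedConj_mul_pow, cs.simple_mul_simple_pow, two_mul, Finset.prod_range_add]
  have : ∀ j, cs.simple t * (cs.simple s * cs.simple t) ^ (M s t + j) =
      cs.simple t * (cs.simple s * cs.simple t) ^ j := by
    intro j
    rw [pow_add, cs.simple_mul_simple_pow, one_mul]
  simp only [this, ← Finset.prod_mul_distrib, Int.units_mul_self]
  simp

/-- The action of a Coxeter group `W` on signed group elements, in which `(s, 1)` plays the role of
the simple root of a simple reflection `s`, and `(t, 1)`, `(t, -1)` that of the positive and the
negative root of a reflection `t`. -/
noncomputable def rootPerm : W →* Equiv.Perm (W × ℤˣ) :=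
  cs.lift ⟨_, cs.isLiftable_signedConj⟩

open scoped Classical in
lemma rootPerm_simple (s : B) (x : W × ℤˣ) : cs.rootPerm (cs.simple s) x =
    (cs.simple s * x.1 * cs.simple s, if x.1 = cs.simple s then -x.2 else x.2) := by
  rw [rootPerm, cs.lift_apply_simple]
  rfl

/-- The sign `η(w, t)` of Bourbaki: for a reflection `t`, it is `-1` if `w` maps the positive root
of `t` to a negative root, and `1` otherwise. -/
noncomputable def rootSign (w t : W) : ℤˣ := (cs.rootPerm w (t, 1)).2

lemma rootPerm_apply (w : W) (x : W × ℤˣ) :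
    cs.rootPerm w x = (w * x.1 * w⁻¹, cs.rootSign w x.1 * x.2) := by
  have key : ∀ x : W × ℤˣ, (cs.rootPerm w x).1 = w * x.1 * w⁻¹ ∧
      cs.rootPerm w (x.1, -x.2) = ((cs.rootPerm w x).1, -(cs.rootPerm w x).2) := by
    induction w using cs.simple_induction_left with
    | one => simp
    | mul_simple_left w s ih =>
      intro x
      obtain ⟨h1, h2⟩ := ih x
      rw [map_mul, Equiv.Perm.mul_apply, Equiv.Perm.mul_apply, h2, rootPerm_simple,
        rootPerm_simple, h1]
      refine ⟨by simp [mul_assoc], ?_⟩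
      ext1
      · rfl
      · dsimp only
        split_ifs <;> rfl
  obtain ⟨t, ε⟩ := x
  ext1
  · exact (key _).1
  · rcases Int.units_eq_one_or ε with rfl | rfl
    · simp [rootSign]
    · simp [rootSign, (key (t, 1)).2]

lemma rootSign_mul (w v t : W) :
    cs.rootSign (w * v) t = cs.rootSign w (v * t * v⁻¹) * cs.rootSign v t := by
  rw [rootSign, map_mul, Equiv.Perm.mul_apply, rootPerm_apply cs v, rootPerm_apply, mul_one]

@[simp] lemma rootSign_one (t : W) : cs.rootSign 1 t = 1 := by simp [rootSign]

lemma rootSign_simple_self (s : B) : cs.rootSign (cs.simple s) (cs.simple s) = -1 := by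
  simp [rootSign, rootPerm_simple]

lemma rootSign_simple_of_ne {s : B} {t : W} (h : t ≠ cs.simple s) :
    cs.rootSign (cs.simple s) t = 1 := by
  simp [rootSign, rootPerm_simple, h]

lemma rootSign_simple_eq_neg_one_iff {s : B} {t : W} :
    cs.rootSign (cs.simple s) t = -1 ↔ t = cs.simple s := by
  refine ⟨fun h => ?_, fun h => h ▸ cs.rootSign_simple_self s⟩
  by_contra hne
  rw [cs.rootSign_simple_of_ne hne] at h
  exact absurd h (by decide)

lemma rootSign_inv (w t : W) : cs.rootSign w⁻¹ (w * t * w⁻¹) = cs.rootSign w t := by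
  have h := cs.rootSign_mul w⁻¹ w t
  rw [inv_mul_cancel, rootSign_one] at h
  exact mul_eq_one_iff_eq_inv.1 h.symm |>.trans (Int.units_inv_eq_self _)

lemma rootSign_ne_one {w t : W} : cs.rootSign w t ≠ 1 ↔ cs.rootSign w t = -1 := by
  rcases Int.units_eq_one_or (cs.rootSign w t) with h | h <;> rw [h] <;> decide

/-- The strong exchange condition, in terms of lengths. -/
theorem length_mul_lt_of_rootSign {w t : W} (h : cs.rootSign w t = -1) :
    cs.length (w * t) < cs.length w := by
  have key : ∀ ω : List B, cs.rootSign (cs.wordProd ω) t = -1 →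
      cs.length (cs.wordProd ω * t) < ω.length := by
    intro ω
    induction ω with
    | nil =>
      intro h
      rw [wordProd_nil, rootSign_one] at h
      exact absurd h (by decide)
    | cons s ω ih =>
      intro h
      rw [List.length_cons, wordProd_cons, mul_assoc]
      by_cases hω : cs.rootSign (cs.wordProd ω) t = -1
      · have := cs.length_mul_le (cs.simple s) (cs.wordProd ω * t)
        rw [length_simple] at this
        have := ih hω
        omega
      · -- The sign changes at `s`, so that `π ω` conjugates `t` to `s` and `π ω * t = s * π ω`.
        rw [wordProd_cons, rootSign_mul, Int.units_eq_one_or _ |>.resolve_right hω, mul_one,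
          rootSign_simple_eq_neg_one_iff, mul_inv_eq_iff_eq_mul] at h
        rw [h, simple_mul_simple_cancel_left]
        exact Nat.lt_succ_of_le (cs.length_wordProd_le ω)
  obtain ⟨ω, hω, rfl⟩ := cs.exists_isReduced w
  rw [hω.eq]
  exact key ω h

theorem rootSign_simple_iff_isRightDescent {w : W} {s : B} :
    cs.rootSign w (cs.simple s) = -1 ↔ cs.IsRightDescent w s := by
  refine ⟨fun h => cs.length_mul_lt_of_rootSign h, fun h => ?_⟩
  by_contra hne
  have h1 : cs.rootSign (w * cs.simple s) (cs.simple s) = -1 := by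
    rw [rootSign_mul, rootSign_simple_self, mul_inv_cancel_right,
      (Int.units_eq_one_or _).resolve_right hne, one_mul]
  have h2 := cs.length_mul_lt_of_rootSign h1
  rw [simple_mul_simple_cancel_right] at h2
  exact lt_asymm h h2

lemma exists_rootSign_simple {w : W} (hw : w ≠ 1) : ∃ s, cs.rootSign w (cs.simple s) = -1 := by
  simpa only [rootSign_simple_iff_isRightDescent] using cs.exists_rightDescent_of_ne_one hw

/-- Elements of `W_X` only change the sign of roots whose reflection is in `W_X`. -/
lemma rootSign_eq_one_of_mem_parabolic {X : Set B} {v t : W} (hv : v ∈ cs.parabolic X)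
    (ht : t ∉ cs.parabolic X) : cs.rootSign v t = 1 := by
  rw [parabolic] at hv ht
  induction hv using Subgroup.closure_induction generalizing t with
  | mem x hx =>
    obtain ⟨i, hi, rfl⟩ := hx
    exact cs.rootSign_simple_of_ne fun e => ht (e ▸ cs.simple_mem_parabolic hi)
  | one => simp
  | mul x y hx hy ihx ihy =>
    rw [rootSign_mul, ihy ht, ihx, mul_one]
    rwa [Subgroup.mul_mem_cancel_right _ (inv_mem hy), Subgroup.mul_mem_cancel_left _ hy]
  | inv x hx ih =>
    have h := ih (t := x⁻¹ * t * x) (by rwa [Subgroup.mul_mem_cancel_right _ hx,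
      Subgroup.mul_mem_cancel_left _ (inv_mem hx)])
    rw [← rootSign_inv] at h
    simpa [mul_assoc] using h

/-- Each coset `w H` contains an element of minimal length. -/
lemma exists_minimal_mul (H : Subgroup W) (w : W) :
    ∃ d, ∃ v ∈ H, w = d * v ∧ ∀ u ∈ H, cs.length d ≤ cs.length (d * u) := by
  obtain ⟨u, hu⟩ : ∃ u : H, ∀ v : H, cs.length (w * u) ≤ cs.length (w * v) :=
    ⟨Function.argmin fun u : H => cs.length (w * u),
      fun v => Function.argmin_le (fun u : H => cs.length (w * u)) v⟩
  refine ⟨w * u, (u : W)⁻¹, inv_mem u.2, by simp, fun v hv => ?_⟩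
  have := hu (u * ⟨v, hv⟩)
  simpa [mul_assoc] using this

/-- If `d` makes no root of `W_X` negative and conjugates a reflection `r` of `W_X` to a simple
reflection, then `r` is simple: otherwise `r` would make negative a simple root of `W_X` other than
its own, and then the simple reflection `d r d⁻¹` would make negative a root other than its own. -/
theorem exists_eq_simple_of_conj_eq_simple {X : Set B} {d r : W} {x : B}
    (hd : ∀ t ∈ cs.parabolic X, cs.rootSign d t = 1) (hr : r ∈ cs.parabolic X)
    (h : d * r * d⁻¹ = cs.simple x) : ∃ s ∈ X, r = cs.simple s := by
  have hr1 : r ≠ 1 := by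
    rintro rfl
    rw [mul_one, mul_inv_cancel] at h
    have := cs.length_simple x
    rw [← h, length_one] at this
    omega
  obtain ⟨s, hs⟩ := cs.exists_rootSign_simple hr1
  have hsX : cs.simple s ∈ cs.parabolic X := by
    by_contra hn
    rw [cs.rootSign_eq_one_of_mem_parabolic hr hn] at hs
    exact absurd hs (by decide)
  refine ⟨s, cs.simple_mem_parabolic_iff.1 hsX, ?_⟩
  have h1 : cs.rootSign (cs.simple x * d) (cs.simple s) = cs.rootSign (d * r) (cs.simple s) := by
    rw [← h, inv_mul_cancel_right]
  rw [rootSign_mul, rootSign_mul, hd _ hsX, hd _ (mul_mem (mul_mem hr hsX) (inv_mem hr)), hs,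
    mul_one, one_mul, rootSign_simple_eq_neg_one_iff, ← h] at h1
  exact (mul_left_cancel (mul_right_cancel h1)).symm

/-! ### Alternating products in dihedral parabolic subgroups -/

lemma prodR_eq_wordProd (b a : B) (n : ℕ) :
    prodR (cs.simple b) (cs.simple a) n = cs.wordProd (alternatingWord b a n) := by
  induction n generalizing a b with
  | zero => simp [prodR, alternatingWord]
  | succ n ih => rw [prodR_succ, alternatingWord_succ, wordProd_concat, ih]

theorem prodR_eq_prodR_iff {a b : B} (hab : a ≠ b) (n : ℕ) :
    prodR (cs.simple b) (cs.simple a) n = prodR (cs.simple a) (cs.simple b) n ↔ M a b ∣ n := by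
  have hinv : cs.simple b * cs.simple a = (cs.simple a * cs.simple b)⁻¹ := by simp
  rw [← cs.simple_mul_simple_pow_eq_one_iff hab, prodR_eq_wordProd, prodR_eq_wordProd,
    prod_alternatingWord_eq_mul_pow, prod_alternatingWord_eq_mul_pow]
  obtain ⟨k, rfl | rfl⟩ := n.even_or_odd'
  · rw [if_pos (by simp), if_pos (by simp), Nat.mul_div_cancel_left _ two_pos, one_mul, one_mul,
      hinv, inv_pow, inv_eq_iff_mul_eq_one, ← pow_add, two_mul]
  · rw [if_neg (by simp), if_neg (by simp), show (2 * k + 1) / 2 = k by omega, hinv, inv_pow,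
      mul_inv_eq_iff_eq_mul, mul_assoc, ← pow_add, ← two_mul,
      ← mul_right_inj (cs.simple a), simple_mul_simple_self, ← mul_assoc, ← pow_succ', eq_comm]

/-- Multiplying an alternating product of length `n` that ends in `a` by `b` on the right amounts
to prolonging it on the left precisely if `m_{a,b}` divides `n + 1`. -/
lemma prodR_conj_eq_iff {a b : B} (hab : a ≠ b) (n : ℕ) :
    prodR (cs.simple b) (cs.simple a) n * cs.simple b * (prodR (cs.simple b) (cs.simple a) n)⁻¹ =
      cs.simple (if Even n then a else b) ↔ M a b ∣ n + 1 := by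
  rw [mul_inv_eq_iff_eq_mul, ← prodR_succ, apply_ite cs.simple, ← prodR_succ', eq_comm,
    cs.prodR_eq_prodR_iff hab]

/-- An alternating product of length `n` ending in `a` changes the sign of the simple root of `b`
each time its length passes a multiple of `m_{a,b}`; there is no change if `m_{a,b} = ∞`, as
`n / 0 = 0`. -/
theorem rootSign_prodR {a b : B} (hab : a ≠ b) (n : ℕ) :
    cs.rootSign (prodR (cs.simple b) (cs.simple a) n) (cs.simple b) = (-1) ^ (n / M a b) := by
  induction n with
  | zero => simp [prodR]
  | succ n ih =>
    rw [prodR_succ', ← apply_ite cs.simple, rootSign_mul, ih, Nat.succ_div]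
    have hiff := cs.prodR_conj_eq_iff hab n
    by_cases h1 : M a b ∣ n + 1
    · rw [hiff.2 h1, rootSign_simple_self, if_pos h1, pow_succ, mul_comm]
    · rw [if_neg h1]
      rw [cs.rootSign_simple_of_ne (mt hiff.1 h1), one_mul, add_zero]

theorem rootSign_prodR_succ {a b : B} (hab : a ≠ b) (n : ℕ) :
    cs.rootSign (prodR (cs.simple b) (cs.simple a) (n + 1)) (cs.simple a) =
      -(-1) ^ (n / M a b) := by
  rw [prodR_succ, rootSign_mul, rootSign_simple_self, mul_inv_cancel_right,
    cs.rootSign_prodR hab.symm, M.symmetric, mul_neg, mul_one]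

/-- Every element of a dihedral standard parabolic subgroup is an alternating product, of length
at most `m_{a,b}`. -/
theorem exists_eq_prodR {a b : B} (hab : a ≠ b) {v : W} (hv : v ∈ cs.parabolic {a, b}) :
    ∃ n, (M a b ≠ 0 → n ≤ M a b) ∧ (v = prodR (cs.simple b) (cs.simple a) n ∨
      v = prodR (cs.simple a) (cs.simple b) n) := by
  have step : ∀ (c d : B), c ≠ d → ∀ n, (M c d ≠ 0 → n ≤ M c d) → ∀ e, e = c ∨ e = d →
      ∃ k, (M c d ≠ 0 → k ≤ M c d) ∧
        (prodR (cs.simple d) (cs.simple c) n * cs.simple e = prodR (cs.simple d) (cs.simple c) k ∨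
        prodR (cs.simple d) (cs.simple c) n * cs.simple e =
          prodR (cs.simple c) (cs.simple d) k) := by
    rintro c d hcd n hn e (rfl | rfl)
    · rcases n with - | n
      · exact ⟨1, Nat.one_le_iff_ne_zero.2, Or.inl rfl⟩
      · exact ⟨n, fun h => (Nat.le_succ n).trans (hn h),
          Or.inr (by rw [prodR_succ, simple_mul_simple_cancel_right])⟩
    · by_cases hnM : M c e ≠ 0 ∧ n = M c e
      · -- The product is the longest element, which has an alternating expression ending in `e`.
        obtain ⟨h0, rfl⟩ := hnM
        obtain ⟨k, hk⟩ := Nat.exists_eq_succ_of_ne_zero h0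
        refine ⟨k, fun _ => by omega, Or.inl ?_⟩
        rw [(cs.prodR_eq_prodR_iff hcd _).2 dvd_rfl, hk, Nat.succ_eq_add_one, prodR_succ,
          simple_mul_simple_cancel_right]
      · exact ⟨n + 1, fun h => by have := hn h; omega, Or.inr rfl⟩
  rw [parabolic] at hv
  have key : ∀ e, e = a ∨ e = b → ∀ v : W, (∃ n, (M a b ≠ 0 → n ≤ M a b) ∧
      (v = prodR (cs.simple b) (cs.simple a) n ∨ v = prodR (cs.simple a) (cs.simple b) n)) →
      ∃ n, (M a b ≠ 0 → n ≤ M a b) ∧ (v * cs.simple e = prodR (cs.simple b) (cs.simple a) n ∨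
        v * cs.simple e = prodR (cs.simple a) (cs.simple b) n) := by
    rintro e he v ⟨n, hn, rfl | rfl⟩
    · exact step a b hab n hn e he
    · rw [M.symmetric a b] at hn ⊢
      obtain ⟨k, hk, h⟩ := step b a hab.symm n hn e he.symm
      exact ⟨k, hk, h.symm⟩
  induction hv using Subgroup.closure_induction_right with
  | one => exact ⟨0, fun _ => Nat.zero_le _, Or.inl rfl⟩
  | mul_right x hx y hy ih =>
    obtain ⟨e, he, rfl⟩ := hy
    exact key e he x ih
  | mul_inv_cancel x hx y hy ih =>
    obtain ⟨e, he, rfl⟩ := hy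
    rw [inv_simple]
    exact key e he x ih

end CoxeterSystem

/-! ### Braid relations between permutations of a path -/

lemma prodR_perm_succ {Ω : Type*} (g f : Equiv.Perm Ω) (n : ℕ) (y : Ω) :
    prodR g f (n + 1) y = prodR f g n (f y) := rfl

/-- Two permutations `g` and `f` moving the points of a path `S 0, …, S p` back and forth, `g`
through the edges starting at even positions and `f` through the others, and applying `L` to a
label at each end of the path where there is no edge to follow, satisfy the braid relation of
length `p + 1` on the path: whichever direction the alternating product takes first, it is
reflected at exactly one end, and ends at the position opposite to the initial one. -/
theorem prodR_eq_prodR_of_path {Ω A : Type*} (g f : Equiv.Perm Ω) (S : ℕ → A → Ω) (L : A → A)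
    (h : ℕ → Equiv.Perm Ω) (hh : ∀ q, h q = if Even q then g else f) (p : ℕ)
    (hr : ∀ q < p, ∀ a, h q (S q a) = S (q + 1) a)
    (hl : ∀ q < p, ∀ a, h q (S (q + 1) a) = S q a)
    (hp : ∀ a, h p (S p a) = S p (L a)) (h0 : ∀ a, f (S 0 a) = S 0 (L a))
    (q : ℕ) (hq : q ≤ p) (a : A) :
    prodR g f (p + 1) (S q a) = prodR f g (p + 1) (S q a) := by
  have h2 : ∀ q, h (q + 2) = h q := by
    intro q
    simp [hh, parity_simps]
  have right : ∀ k q n a, q + k ≤ p → prodR (h (q + 1)) (h q) (n + k) (S q a) =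
      prodR (h (q + k + 1)) (h (q + k)) n (S (q + k) a) := by
    intro k
    induction k with
    | zero => intro q n a _; rfl
    | succ k ih =>
      intro q n a hk
      rw [← add_assoc, prodR_perm_succ, hr q (by omega), ← h2 q, ih (q + 1) n a (by omega),
        add_right_comm q 1 k, add_assoc q k 1]
  have left : ∀ k q n a, q + k ≤ p → prodR (h (q + k)) (h (q + k + 1)) (n + k) (S (q + k) a) =
      prodR (h q) (h (q + 1)) n (S q a) := by
    intro k
    induction k with
    | zero => intro q n a _; rfl
    | succ k ih =>
      intro q n a hk
      rw [← add_assoc, ← add_assoc, prodR_perm_succ, h2, hl _ (by omega), ih q n a (by omega)]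
  obtain ⟨r, rfl⟩ := Nat.exists_eq_add_of_le hq
  have hR : prodR (h (q + 1)) (h q) (q + r + 1) (S q a) = S r (L a) := by
    have e := left q r 0 (L a) (by omega)
    rw [zero_add, add_comm r q] at e
    rw [add_right_comm, right r q (q + 1) a le_rfl, prodR_perm_succ, hp, e]
    rfl
  have hL : prodR (h q) (h (q + 1)) (q + r + 1) (S q a) = S r (L a) := by
    have e := left q 0 (r + 1) a (by omega)
    have e' := right r 0 0 (L a) (by omega)
    have h1 : h (0 + 1) = f := by simp [hh]
    rw [zero_add] at e
    simp only [Nat.zero_add] at e'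
    rw [add_assoc, add_comm q (r + 1), e, prodR_perm_succ, h1, h0, ← h1, Nat.zero_add, e']
    rfl
  rw [hh q, hh (q + 1)] at hR hL
  rcases q.even_or_odd with he | ho
  · rw [if_pos he, if_neg (by simpa [parity_simps] using he)] at hR hL
    rw [hR, hL]
  · rw [if_neg (Nat.not_even_iff_odd.2 ho), if_pos ho.add_one] at hR hL
    rw [hR, hL]

/-! ### Artin groups and their parabolic subgroups -/

/-- The Artin group of a Coxeter matrix, given by its presentation. -/
def ArtinGroup {B : Type*} (M : CoxeterMatrix B) : Type _ :=
  PresentedGroup {g : FreeGroup B | ∃ s t, s ≠ t ∧ M s t ≠ 0 ∧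
    g = prodR (FreeGroup.of t) (FreeGroup.of s) (M s t) *
      (prodR (FreeGroup.of s) (FreeGroup.of t) (M s t))⁻¹}

namespace ArtinGroup

variable {B : Type*} {M : CoxeterMatrix B}

instance : Group (ArtinGroup M) := inferInstanceAs (Group (PresentedGroup _))

/-- The standard generator `σ_s` of the Artin group. -/
def gen (M : CoxeterMatrix B) (s : B) : ArtinGroup M := PresentedGroup.of s

theorem prodR_gen {s t : B} (hst : s ≠ t) (h : M s t ≠ 0) :
    prodR (gen M t) (gen M s) (M s t) = prodR (gen M s) (gen M t) (M s t) := by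
  have h1 := PresentedGroup.mk_eq_mk_of_mul_inv_mem
    (rels := {g : FreeGroup B | ∃ s t, s ≠ t ∧ M s t ≠ 0 ∧
      g = prodR (FreeGroup.of t) (FreeGroup.of s) (M s t) *
        (prodR (FreeGroup.of s) (FreeGroup.of t) (M s t))⁻¹}) ⟨s, t, hst, h, rfl⟩
  rwa [map_prodR, map_prodR] at h1

/-- The homomorphism from an Artin group defined by images of the generators satisfying the braid
relations. -/
def lift {G : Type*} [Group G] (f : B → G) (hf : ∀ s t, s ≠ t → M s t ≠ 0 →
    prodR (f t) (f s) (M s t) = prodR (f s) (f t) (M s t)) : ArtinGroup M →* G :=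
  PresentedGroup.toGroup (f := f) <| by
    rintro _ ⟨s, t, hst, h, rfl⟩
    rw [map_mul, map_inv, mul_inv_eq_one, map_prodR, map_prodR, FreeGroup.lift_apply_of,
      FreeGroup.lift_apply_of]
    exact hf s t hst h

@[simp] lemma lift_gen {G : Type*} [Group G] (f : B → G) (hf) (s : B) :
    lift (M := M) f hf (gen M s) = f s :=
  PresentedGroup.toGroup.of _

theorem closure_range_gen : Subgroup.closure (Set.range (gen M)) = ⊤ :=
  PresentedGroup.closure_range_of _

theorem hom_ext {G : Type*} [Monoid G] {f g : ArtinGroup M →* G}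
    (h : ∀ s, f (gen M s) = g (gen M s)) : f = g :=
  MonoidHom.eq_of_eqOn_dense closure_range_gen <| by
    rintro _ ⟨s, rfl⟩
    exact h s

/-- The standard parabolic subgroup generated by the generators with index in `X`. -/
def parabolic (M : CoxeterMatrix B) (X : Set B) : Subgroup (ArtinGroup M) :=
  Subgroup.closure (gen M '' X)

lemma gen_mem_parabolic {X : Set B} {s : B} (h : s ∈ X) : gen M s ∈ parabolic M X :=
  Subgroup.subset_closure ⟨s, h, rfl⟩

lemma parabolic_mono {X Y : Set B} (h : X ⊆ Y) : parabolic M X ≤ parabolic M Y :=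
  Subgroup.closure_mono (Set.image_mono h)

variable {W : Type*} [Group W] (cs : CoxeterSystem M W)

/-- The projection of an Artin group to its Coxeter group. -/
noncomputable def toCoxeter : ArtinGroup M →* W :=
  lift cs.simple fun _ _ hst _ => (cs.prodR_eq_prodR_iff hst _).2 dvd_rfl

@[simp] lemma toCoxeter_gen (s : B) : toCoxeter cs (gen M s) = cs.simple s := lift_gen _ _ s

include cs in
lemma gen_mem_parabolic_iff {X : Set B} {s : B} : gen M s ∈ parabolic M X ↔ s ∈ X := by
  refine ⟨fun h => ?_, gen_mem_parabolic⟩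
  have : parabolic M X ≤ (cs.parabolic X).comap (toCoxeter cs) := by
    refine (Subgroup.closure_le _).2 ?_
    rintro _ ⟨s, hs, rfl⟩
    rw [SetLike.mem_coe, Subgroup.mem_comap, toCoxeter_gen]
    exact cs.simple_mem_parabolic hs
  have h1 := this h
  rwa [Subgroup.mem_comap, toCoxeter_gen, cs.simple_mem_parabolic_iff] at h1

include cs in
lemma gen_injective : Function.Injective (gen M) := fun s t h => by
  have h1 : gen M s ∈ parabolic M {t} := h ▸ gen_mem_parabolic rfl
  simpa using (gen_mem_parabolic_iff cs).1 h1

/-- The element `w` conjugates the simple reflection of some `x ∈ X` to that of `s`. -/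
def IsLoop (X : Set B) (w : W) (s : B) : Prop :=
  ∃ x ∈ X, w * cs.simple x * w⁻¹ = cs.simple s

variable {cs}

lemma isLoop_mul_iff {X : Set B} {w : W} {s : B} :
    IsLoop cs X (cs.simple s * w) s ↔ IsLoop cs X w s := by
  refine exists_congr fun x => and_congr_right fun _ => ?_
  have e : cs.simple s * w * cs.simple x * (cs.simple s * w)⁻¹ =
      cs.simple s * (w * cs.simple x * w⁻¹) * (cs.simple s)⁻¹ := by
    group
  rw [e, mul_inv_eq_iff_eq_mul, mul_right_inj]

lemma IsLoop.choose_eq {X : Set B} {w : W} {s x : B} (h : IsLoop cs X w s)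
    (hx : w * cs.simple x * w⁻¹ = cs.simple s) : h.choose = x :=
  cs.simple_injective <| mul_left_cancel <| mul_right_cancel <| h.choose_spec.2.trans hx.symm

variable (cs)

open scoped Classical in
/-- The move of `σ_s` on pairs `(w, a)`, where `w` is thought of as the shortest element of the
coset `w W_X`: if `s` fixes the coset, because `w` conjugates some `x ∈ X` to `s`, then `a` is
multiplied by `σ_x`, and otherwise `w` is multiplied by `s`. -/
noncomputable def move (X : Set B) (s : B) : Equiv.Perm (W × ArtinGroup M) where
  toFun y := if h : IsLoop cs X y.1 s then (y.1, gen M h.choose * y.2)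
    else (cs.simple s * y.1, y.2)
  invFun y := if h : IsLoop cs X y.1 s then (y.1, (gen M h.choose)⁻¹ * y.2)
    else (cs.simple s * y.1, y.2)
  left_inv y := by
    by_cases h : IsLoop cs X y.1 s
    · simp [h]
    · simp [h, isLoop_mul_iff]
  right_inv y := by
    by_cases h : IsLoop cs X y.1 s
    · simp [h]
    · simp [h, isLoop_mul_iff]

variable {cs}

lemma move_of_eq {X : Set B} {s x : B} {w : W} (hx : x ∈ X)
    (h : w * cs.simple x * w⁻¹ = cs.simple s) (a : ArtinGroup M) :
    move cs X s (w, a) = (w, gen M x * a) := by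
  have hl : IsLoop cs X w s := ⟨x, hx, h⟩
  exact (dif_pos hl).trans (by rw [hl.choose_eq h])

lemma move_of_not_isLoop {X : Set B} {s : B} {w : W} (h : ¬ IsLoop cs X w s)
    (a : ArtinGroup M) : move cs X s (w, a) = (cs.simple s * w, a) :=
  dif_neg h

variable (cs)

/-- The elements `w` of the Coxeter group that make no simple root of `W_X` negative; these are the
shortest representatives of the cosets `w W_X`. -/
def minReps (X : Set B) : Set W :=
  {w | ∀ x ∈ X, cs.rootSign w (cs.simple x) = 1}

variable {cs}

/-- As `s` changes no sign except for its own root, a move that is not a loop preserves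
`minReps cs X`. -/
lemma simple_mul_mem_minReps {X : Set B} {s : B} {w : W} (hw : w ∈ minReps cs X)
    (h : ¬ IsLoop cs X w s) : cs.simple s * w ∈ minReps cs X := by
  intro x hx
  rw [CoxeterSystem.rootSign_mul, hw x hx, mul_one]
  exact CoxeterSystem.rootSign_simple_of_ne _ fun e => h ⟨x, hx, e⟩

lemma move_mem_minReps_iff (X : Set B) (s : B) (y : W × ArtinGroup M) :
    (move cs X s y).1 ∈ minReps cs X ↔ y.1 ∈ minReps cs X := by
  obtain ⟨w, a⟩ := y
  by_cases h : IsLoop cs X w s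
  · obtain ⟨x, hx, hxs⟩ := h
    rw [move_of_eq hx hxs]
  · rw [move_of_not_isLoop h]
    refine ⟨fun h' => ?_, fun h' => simple_mul_mem_minReps h' h⟩
    simpa using simple_mul_mem_minReps h' (mt isLoop_mul_iff.1 h)

/-! ### The braid relations between the moves

An element `w` is written as `v * u`, where `v` lies in the dihedral parabolic subgroup for `s` and
`t`, and `u⁻¹` is dominant for this subgroup. -/

section Braid

variable {X : Set B} {s t : B} {u v : W}
  (hu : ∀ r ∈ cs.parabolic {s, t}, cs.rootSign u⁻¹ r = 1) (hv : v ∈ cs.parabolic {s, t})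

include hu in
lemma conj_eq_or_eq_of_mem_parabolic {z : B} (h : u * cs.simple z * u⁻¹ ∈ cs.parabolic {s, t}) :
    u * cs.simple z * u⁻¹ = cs.simple s ∨ u * cs.simple z * u⁻¹ = cs.simple t := by
  obtain ⟨c, hc, e⟩ := cs.exists_eq_simple_of_conj_eq_simple (x := z) hu h (by simp [mul_assoc])
  rcases hc with rfl | rfl
  exacts [Or.inl e, Or.inr e]

include hu hv in
lemma IsLoop.exists_conj {c : B} (hc : c ∈ ({s, t} : Set B)) (h : IsLoop cs X (v * u) c) :
    ∃ z ∈ X, (u * cs.simple z * u⁻¹ = cs.simple s ∨ u * cs.simple z * u⁻¹ = cs.simple t) ∧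
      v * (u * cs.simple z * u⁻¹) * v⁻¹ = cs.simple c := by
  obtain ⟨z, hz, e⟩ := h
  have e' : v * (u * cs.simple z * u⁻¹) * v⁻¹ = cs.simple c := by
    rw [← e]
    group
  refine ⟨z, hz, conj_eq_or_eq_of_mem_parabolic hu ?_, e'⟩
  rw [← eq_mul_inv_iff_mul_eq, inv_inv, ← eq_inv_mul_iff_mul_eq] at e'
  rw [e']
  exact mul_mem (inv_mem hv) (mul_mem (cs.simple_mem_parabolic hc) hv)

include hu hv in
/-- If neither `s` nor `t` is conjugate to an element of `X` by `u`, then no loop is met, and the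
braid relation comes from that in the Coxeter group. -/
lemma prodR_move_of_not_isLoop (hst : s ≠ t) (hs : ¬ IsLoop cs X u s) (ht : ¬ IsLoop cs X u t)
    (a : ArtinGroup M) :
    prodR (move cs X t) (move cs X s) (M s t) (v * u, a) =
      prodR (move cs X s) (move cs X t) (M s t) (v * u, a) := by
  have hc : ∀ c ∈ ({s, t} : Set B), ∀ v ∈ cs.parabolic {s, t},
      move cs X c (v * u, a) = (cs.simple c * v * u, a) := by
    intro c hc v hv
    rw [move_of_not_isLoop, mul_assoc]
    intro hl
    obtain ⟨z, hz, e | e, -⟩ := hl.exists_conj hu hv hc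
    exacts [hs ⟨z, hz, e⟩, ht ⟨z, hz, e⟩]
  have key : ∀ n, ∀ c ∈ ({s, t} : Set B), ∀ d ∈ ({s, t} : Set B), ∀ v ∈ cs.parabolic {s, t},
      prodR (move cs X d) (move cs X c) n (v * u, a) =
        (prodR (cs.simple d) (cs.simple c) n * v * u, a) := by
    intro n
    induction n with
    | zero => intros; simp [prodR]
    | succ n ih =>
      intro c h1 d h2 v hv
      rw [prodR_perm_succ, hc c h1 v hv, ih d h2 c h1 _ (mul_mem (cs.simple_mem_parabolic h1) hv),
        prodR_succ]
      simp only [mul_assoc]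
  rw [key _ s (by simp) t (by simp) v hv, key _ t (by simp) s (by simp) v hv,
    (cs.prodR_eq_prodR_iff hst _).2 dvd_rfl]

lemma rootSign_of_mem_minReps (hX : v * u ∈ minReps cs X) {x : B} (hx : x ∈ X) {c : B}
    (hu : cs.rootSign u⁻¹ (cs.simple c) = 1)
    (hxs : u * cs.simple x * u⁻¹ = cs.simple c) : cs.rootSign v (cs.simple c) = 1 := by
  have h1 := hX x hx
  have h2 := cs.rootSign_inv u (cs.simple x)
  rw [hxs, hu] at h2
  rwa [CoxeterSystem.rootSign_mul, ← h2, mul_one, hxs] at h1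

include hu hv in
/-- If both `s` and `t` are conjugate to elements of `X` by `u`, then `v` must be trivial, and the
braid relation comes from that between the corresponding generators with index in `X`. -/
lemma prodR_move_of_eq_eq (hst : s ≠ t) (hM : M s t ≠ 0)
    (hX : v * u ∈ minReps cs X) {x y : B} (hx : x ∈ X) (hy : y ∈ X)
    (hxs : u * cs.simple x * u⁻¹ = cs.simple s) (hyt : u * cs.simple y * u⁻¹ = cs.simple t)
    (a : ArtinGroup M) :
    prodR (move cs X t) (move cs X s) (M s t) (v * u, a) =
      prodR (move cs X s) (move cs X t) (M s t) (v * u, a) := by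
  have hs := rootSign_of_mem_minReps hX hx (hu _ (cs.simple_mem_parabolic (by simp))) hxs
  have ht := rootSign_of_mem_minReps hX hy (hu _ (cs.simple_mem_parabolic (by simp))) hyt
  have hv1 : v = 1 := by
    by_contra hne
    obtain ⟨c, hc⟩ := cs.exists_rootSign_simple hne
    have hcm : cs.simple c ∈ cs.parabolic {s, t} := by
      by_contra hn
      rw [cs.rootSign_eq_one_of_mem_parabolic hv hn] at hc
      exact absurd hc (by decide)
    rcases cs.simple_mem_parabolic_iff.1 hcm with rfl | rfl
    · exact absurd (hs.symm.trans hc) (by decide)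
    · exact absurd (ht.symm.trans hc) (by decide)
  subst hv1
  rw [one_mul]
  have hxy : x ≠ y := by
    rintro rfl
    exact hst (cs.simple_injective (hxs.symm.trans hyt))
  have hMxy : M x y = M s t := by
    rw [← cs.orderOf_simple_mul_simple hxy, ← cs.orderOf_simple_mul_simple hst, ← hxs, ← hyt]
    have e : u * cs.simple x * u⁻¹ * (u * cs.simple y * u⁻¹) =
        MulAut.conj u (cs.simple x * cs.simple y) := by
      rw [MulAut.conj_apply]
      group
    rw [e]
    exact (orderOf_injective (MulAut.conj u).toMonoidHom (MulAut.conj u).injective _).symm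
  have key : ∀ (f g : Equiv.Perm (W × ArtinGroup M)) (c d : ArtinGroup M),
      (∀ b, f (u, b) = (u, c * b)) → (∀ b, g (u, b) = (u, d * b)) → ∀ n b,
      prodR g f n (u, b) = (u, prodR d c n * b) := by
    intro f g c d hf hg n
    induction n generalizing f g c d with
    | zero => simp [prodR]
    | succ n ih =>
      intro b
      rw [prodR_perm_succ, hf, ih g f d c hg hf, prodR_succ, mul_assoc]
  have hfs := move_of_eq (M := M) hx hxs
  have hgt := move_of_eq (M := M) hy hyt
  rw [key _ _ _ _ hfs hgt, key _ _ _ _ hgt hfs, ← hMxy, prodR_gen hxy (hMxy ▸ hM)]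

include hu hv in
/-- If only `s` is conjugate to an element of `X` by `u`, then the pairs that the moves of `s` and
`t` reach from `(u, a)` form a path with `m_{s,t}` vertices. -/
lemma prodR_move_of_eq (hst : s ≠ t) (hM : M s t ≠ 0) (hX : v * u ∈ minReps cs X) {x : B}
    (hx : x ∈ X) (hxs : u * cs.simple x * u⁻¹ = cs.simple s) (ht : ¬ IsLoop cs X u t)
    (a : ArtinGroup M) :
    prodR (move cs X t) (move cs X s) (M s t) (v * u, a) =
      prodR (move cs X s) (move cs X t) (M s t) (v * u, a) := by
  have hs := rootSign_of_mem_minReps hX hx (hu _ (cs.simple_mem_parabolic (by simp))) hxs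
  -- `v` is one of the vertices of the path
  obtain ⟨q, hqM, rfl⟩ : ∃ q < M s t, v = prodR (cs.simple s) (cs.simple t) q := by
    obtain ⟨q, hq, rfl | rfl⟩ := cs.exists_eq_prodR hst.symm
      (by rwa [Set.pair_comm] : v ∈ cs.parabolic {t, s})
    · rw [M.symmetric t s] at hq
      refine ⟨q, lt_of_le_of_ne (hq hM) ?_, rfl⟩
      rintro rfl
      rw [cs.rootSign_prodR hst.symm, M.symmetric t s, Nat.div_self (Nat.pos_of_ne_zero hM)] at hs
      exact absurd hs (by decide)
    · rw [M.symmetric t s] at hq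
      rcases q with - | q
      · exact ⟨0, Nat.pos_of_ne_zero hM, rfl⟩
      · rw [cs.rootSign_prodR_succ hst, Nat.div_eq_of_lt (hq hM)] at hs
        exact absurd hs (by decide)
  -- the loops at the vertices of the path
  have hloop : ∀ q, ∀ c ∈ ({s, t} : Set B),
      IsLoop cs X (prodR (cs.simple s) (cs.simple t) q * u) c →
      prodR (cs.simple s) (cs.simple t) q * cs.simple s *
        (prodR (cs.simple s) (cs.simple t) q)⁻¹ = cs.simple c := by
    intro q c hc hl
    have hm : prodR (cs.simple s) (cs.simple t) q ∈ cs.parabolic {s, t} :=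
      prodR_mem (cs.simple_mem_parabolic (by simp)) (cs.simple_mem_parabolic (by simp)) q
    obtain ⟨z, hz, e | e, h⟩ := hl.exists_conj hu hm hc
    · rwa [e] at h
    · exact absurd ⟨z, hz, e⟩ ht
  have hconj := fun q => cs.prodR_conj_eq_iff hst.symm q
  rw [M.symmetric t s] at hconj
  have hnext : ∀ q < M s t - 1,
      ¬ IsLoop cs X (prodR (cs.simple s) (cs.simple t) q * u) (if Even q then t else s) := by
    intro q hq hl
    have := hloop q _ (by split_ifs <;> simp) hl
    rw [hconj] at this
    have := Nat.le_of_dvd (by omega) this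
    omega
  obtain ⟨p, hp⟩ := Nat.exists_eq_succ_of_ne_zero hM
  have hh : ∀ q : ℕ, move cs X (if Even q then t else s) =
      if Even q then move cs X t else move cs X s := fun q => apply_ite (move cs X) _ _ _
  rw [hp, Nat.succ_eq_add_one]
  refine prodR_eq_prodR_of_path (move cs X t) (move cs X s)
    (fun (q : ℕ) a => (prodR (cs.simple s) (cs.simple t) q * u, a)) (fun a => gen M x * a)
    (fun q : ℕ => move cs X (if Even q then t else s)) hh p ?_ ?_ ?_ ?_ q (by omega) a
  · intro q hq a
    rw [move_of_not_isLoop (hnext q (by omega)), prodR_succ', ← apply_ite cs.simple, mul_assoc]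
  · intro q hq a
    have := hnext q (by omega)
    rw [← isLoop_mul_iff] at this
    rw [prodR_succ', ← apply_ite cs.simple, mul_assoc, move_of_not_isLoop this,
      CoxeterSystem.simple_mul_simple_cancel_left]
  · intro a
    refine move_of_eq hx ?_ a
    rw [← (hconj p).2 (by rw [hp]), ← hxs]
    group
  · intro a
    exact move_of_eq hx (by simpa [prodR] using hxs) a

end Braid

/-- The moves satisfy the braid relations on the pairs `(w, a)` with `w ∈ minReps cs X`. -/
theorem prodR_move {X : Set B} {s t : B} (hst : s ≠ t) (hM : M s t ≠ 0)
    (y : W × ArtinGroup M) (hy : y.1 ∈ minReps cs X) :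
    prodR (move cs X t) (move cs X s) (M s t) y = prodR (move cs X s) (move cs X t) (M s t) y := by
  obtain ⟨w, a⟩ := y
  obtain ⟨d, v, hv, hw, hmin⟩ := cs.exists_minimal_mul (cs.parabolic {s, t}) w⁻¹
  obtain rfl : w = v⁻¹ * d⁻¹ := by rw [← mul_inv_rev, ← hw, inv_inv]
  have hu : ∀ r ∈ cs.parabolic {s, t}, cs.rootSign d⁻¹⁻¹ r = 1 := by
    intro r hr
    rw [inv_inv]
    by_contra hne
    exact absurd (cs.length_mul_lt_of_rootSign (cs.rootSign_ne_one.1 hne)) (hmin r hr).not_gt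
  by_cases hs : IsLoop cs X d⁻¹ s <;> by_cases ht : IsLoop cs X d⁻¹ t
  · obtain ⟨x, hx, hxs⟩ := hs
    obtain ⟨y, hy', hyt⟩ := ht
    exact prodR_move_of_eq_eq hu (inv_mem hv) hst hM hy hx hy' hxs hyt a
  · obtain ⟨x, hx, hxs⟩ := hs
    exact prodR_move_of_eq hu (inv_mem hv) hst hM hy hx hxs ht a
  · obtain ⟨x, hx, hxt⟩ := ht
    rw [Set.pair_comm] at hu hv
    rw [M.symmetric s t] at hM ⊢
    exact (prodR_move_of_eq hu (inv_mem hv) hst.symm hM hy hx hxt hs a).symm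
  · exact prodR_move_of_not_isLoop hu (inv_mem hv) hst hs ht a

variable (cs)

/-- The action of the Artin group on pairs `(w, a)` with `w ∈ minReps cs X`. It lifts the action of
the Coxeter group on the cosets of `W_X`; the second component records the generators with index
in `X` that are met while the coset does not move. -/
noncomputable def moveHom (X : Set B) :
    ArtinGroup M →* Equiv.Perm {y : W × ArtinGroup M // y.1 ∈ minReps cs X} :=
  lift (fun s => (move cs X s).subtypePerm (move_mem_minReps_iff X s)) <| by
    have key : ∀ s t n (y : {y : W × ArtinGroup M // y.1 ∈ minReps cs X}),
        (prodR ((move cs X t).subtypePerm (move_mem_minReps_iff X t))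
        ((move cs X s).subtypePerm (move_mem_minReps_iff X s)) n y : W × ArtinGroup M) =
        prodR (move cs X t) (move cs X s) n y := by
      intro s t n
      induction n generalizing s t with
      | zero => intro y; rfl
      | succ n ih => intro y; rw [prodR_perm_succ, ih, prodR_perm_succ]; rfl
    intro s t hst hM
    ext1 y
    apply Subtype.ext
    rw [key, key, prodR_move hst hM _ y.2]

lemma moveHom_gen (X : Set B) (s : B) (y : {y : W × ArtinGroup M // y.1 ∈ minReps cs X}) :
    (moveHom cs X (gen M s) y : W × ArtinGroup M) = move cs X s y := by
  rw [moveHom, lift_gen]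
  rfl

lemma one_mem_minReps (X : Set B) : (1 : W) ∈ minReps cs X := fun _ _ => cs.rootSign_one _

lemma moveHom_of_mem {X : Set B} {k : ArtinGroup M} (hk : k ∈ parabolic M X) (a : ArtinGroup M) :
    moveHom cs X k ⟨(1, a), one_mem_minReps cs X⟩ = ⟨(1, k * a), one_mem_minReps cs X⟩ := by
  induction hk using Subgroup.closure_induction generalizing a with
  | mem x hx =>
    obtain ⟨s, hs, rfl⟩ := hx
    apply Subtype.ext
    rw [moveHom_gen, move_of_eq hs (by simp)]
  | one => simp
  | mul x y _ _ hx hy => rw [map_mul, Equiv.Perm.mul_apply, hy, hx, mul_assoc]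
  | inv x _ hx => rw [map_inv, Equiv.Perm.inv_eq_iff_eq, hx, mul_inv_cancel_left]

lemma moveHom_mem {X Y : Set B} {k : ArtinGroup M} (hk : k ∈ parabolic M Y)
    (y : {y : W × ArtinGroup M // y.1 ∈ minReps cs X}) :
    ((moveHom cs X k y).1.1 ∈ cs.parabolic Y ∧ (moveHom cs X k y).1.2 ∈ parabolic M (X ∩ Y)) ↔
      (y.1.1 ∈ cs.parabolic Y ∧ y.1.2 ∈ parabolic M (X ∩ Y)) := by
  induction hk using Subgroup.closure_induction generalizing y with
  | mem g hg =>
    obtain ⟨s, hs, rfl⟩ := hg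
    obtain ⟨⟨w, a⟩, hy⟩ := y
    rw [moveHom_gen]
    have hsW := cs.simple_mem_parabolic hs
    by_cases h : IsLoop cs X w s
    · obtain ⟨x, hx, hxs⟩ := h
      rw [move_of_eq hx hxs]
      refine and_congr_right fun hw => ?_
      have hxY : x ∈ Y := by
        rw [← cs.simple_mem_parabolic_iff]
        have : cs.simple x = w⁻¹ * cs.simple s * w := by
          rw [← hxs]
          group
        rw [this]
        exact mul_mem (mul_mem (inv_mem hw) hsW) hw
      exact Subgroup.mul_mem_cancel_left _ (gen_mem_parabolic ⟨hx, hxY⟩)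
    · rw [move_of_not_isLoop h, Subgroup.mul_mem_cancel_left _ hsW]
  | one => simp
  | mul g h _ _ ihg ihh => rw [map_mul, Equiv.Perm.mul_apply, ihg, ihh]
  | inv g _ ih => rw [← ih, map_inv, ← Equiv.Perm.mul_apply, mul_inv_cancel, Equiv.Perm.one_apply]

include cs in
/-- Intersections of standard parabolic subgroups of an Artin group are standard parabolic. The
orbit of `(1, 1)` recovers an element of the subgroup for `X`, and if this element is also in the
subgroup for `Y`, the second component stays in that for `X ∩ Y`. -/
theorem mem_parabolic_inter {X Y : Set B} {k : ArtinGroup M} (hX : k ∈ parabolic M X)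
    (hY : k ∈ parabolic M Y) : k ∈ parabolic M (X ∩ Y) := by
  have h := (moveHom_mem cs hY ⟨(1, 1), one_mem_minReps cs X⟩).2 ⟨one_mem _, one_mem _⟩
  rw [moveHom_of_mem cs hX, mul_one] at h
  exact h.2

theorem exists_finset_mem_parabolic (k : ArtinGroup M) :
    ∃ F : Finset B, k ∈ parabolic M (F : Set B) := by
  classical
  have hk : k ∈ Subgroup.closure (Set.range (gen M)) := closure_range_gen ▸ Subgroup.mem_top k
  induction hk using Subgroup.closure_induction with
  | mem g hg =>
    obtain ⟨s, rfl⟩ := hg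
    exact ⟨{s}, gen_mem_parabolic (by simp)⟩
  | one => exact ⟨∅, one_mem _⟩
  | mul g h _ _ ihg ihh =>
    obtain ⟨F, hF⟩ := ihg
    obtain ⟨F', hF'⟩ := ihh
    exact ⟨F ∪ F', mul_mem (parabolic_mono (by simp) hF) (parabolic_mono (by simp) hF')⟩
  | inv g _ ih =>
    obtain ⟨F, hF⟩ := ih
    exact ⟨F, inv_mem hF⟩

/-- An element that can be expressed without any given generator is trivial. -/
theorem eq_one_of_forall_mem_parabolic {k : ArtinGroup M}
    (h : ∀ b, k ∈ parabolic M {c | c ≠ b}) : k = 1 := by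
  classical
  obtain ⟨F, hF⟩ := exists_finset_mem_parabolic k
  induction F using Finset.induction_on with
  | empty => simpa [parabolic] using hF
  | insert b F _ ih =>
    refine ih (parabolic_mono ?_ (mem_parabolic_inter M.toCoxeterSystem hF (h b)))
    rintro c ⟨h1, h2⟩
    exact (Finset.mem_insert.1 h1).resolve_left h2

end ArtinGroup

/-! ### Amalgamated products -/

section Amalgam

open Monoid

variable {A : Type*} [Group A] (P : Bool → Subgroup A) (H : Subgroup A)

/-- A list of elements alternating between `P true \ H` and `P false \ H`, each paired with the
name of the subgroup from which it is taken. -/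
def IsAlternating (L : List (Bool × A)) : Prop :=
  (∀ x ∈ L, x.2 ∈ P x.1 ∧ x.2 ∉ H) ∧ L.IsChain fun x y => x.1 ≠ y.1

/-- No product of a nonempty alternating list lies in `H`; together with the fact that the two
subgroups generate, this says that the group is their amalgamated product over `H`. -/
def IsAmalgam : Prop := ∀ L, IsAlternating P H L → L ≠ [] → (L.map Prod.snd).prod ∉ H

variable {P H}

/-- The normal form theorem, transported from `Monoid.PushoutI`. -/
theorem isAmalgam_of_pushoutI (hH : ∀ i, H ≤ P i)
    (Ψ : A →* PushoutI fun i => Subgroup.inclusion (hH i))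
    (hΨ : ∀ i (p : P i), Ψ p = PushoutI.of i p) : IsAmalgam P H := by
  intro L hL hne hmem
  have hφ : ∀ i, Function.Injective (Subgroup.inclusion (hH i)) :=
    fun i => Subgroup.inclusion_injective (hH i)
  let w : CoprodI.Word fun i => P i :=
    { toList := L.pmap (fun x h => ⟨x.1, ⟨x.2, h⟩⟩) fun x hx => (hL.1 x hx).1
      ne_one := by
        intro l hl
        obtain ⟨x, hx, rfl⟩ := List.mem_pmap.1 hl
        intro h1
        have : x.2 = 1 := congrArg Subtype.val h1
        exact (hL.1 x hx).2 (this ▸ one_mem H)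
      chain_ne := by
        refine List.isChain_pmap_of_isChain ?_ hL.2 _
        exact fun _ _ _ _ h => h }
  have hw : PushoutI.Reduced (fun i => Subgroup.inclusion (hH i)) w := by
    intro l hl
    obtain ⟨x, hx, rfl⟩ := List.mem_pmap.1 hl
    rintro ⟨h, hh⟩
    have e : (h : A) = x.2 := congrArg Subtype.val hh
    exact (hL.1 x hx).2 (e ▸ h.2)
  have hprod : ∀ (L : List (Bool × A)) (h : ∀ x ∈ L, x.2 ∈ P x.1), Ψ (L.map Prod.snd).prod =
      PushoutI.ofCoprodI (G := fun i => P i)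
        (((L.pmap (fun x h => ⟨x.1, ⟨x.2, h⟩⟩) h : List (Σ i : Bool, P i)).map
        fun l => CoprodI.of (M := fun i => P i) l.2).prod) := by
    intro L
    induction L with
    | nil => intro h; simp
    | cons x L ih =>
      intro h
      rw [List.map_cons, List.prod_cons, map_mul, ih fun y hy => h y (List.mem_cons_of_mem _ hy)]
      simp only [List.pmap_cons, List.map_cons, List.prod_cons, map_mul, PushoutI.ofCoprodI_of]
      rw [← hΨ]
  have hbase : Ψ (L.map Prod.snd).prod ∈
      (PushoutI.base fun i => Subgroup.inclusion (hH i)).range := by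
    refine ⟨⟨_, hmem⟩, ?_⟩
    rw [← PushoutI.of_apply_eq_base _ true, ← hΨ]
    rfl
  rw [hprod L fun x hx => (hL.1 x hx).1] at hbase
  have := congrArg CoprodI.Word.toList (hw.eq_empty_of_mem_range hφ hbase)
  rw [CoprodI.Word.empty, List.pmap_eq_nil_iff] at this
  exact hne this

lemma IsAlternating.tail {x : Bool × A} {L : List (Bool × A)} (h : IsAlternating P H (x :: L)) :
    IsAlternating P H L :=
  ⟨fun y hy => h.1 y (List.mem_cons_of_mem _ hy), h.2.tail⟩

lemma IsAlternating.replace_head {i : Bool} {x y : A} {L : List (Bool × A)}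
    (h : IsAlternating P H ((i, x) :: L)) (hy : y ∈ P i) (hyH : y ∉ H) :
    IsAlternating P H ((i, y) :: L) := by
  refine ⟨?_, ?_⟩
  · intro z hz
    rcases List.mem_cons.1 hz with rfl | hz
    · exact ⟨hy, hyH⟩
    · exact h.1 z (List.mem_cons_of_mem _ hz)
  · have := h.2
    rw [List.isChain_cons] at this ⊢
    exact this

lemma IsAlternating.cons {i j : Bool} {x y : A} {L : List (Bool × A)}
    (h : IsAlternating P H ((i, x) :: L)) (hij : j ≠ i) (hy : y ∈ P j) (hyH : y ∉ H) :
    IsAlternating P H ((j, y) :: (i, x) :: L) := by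
  refine ⟨?_, List.isChain_cons_cons.2 ⟨hij, h.2⟩⟩
  intro z hz
  rcases List.mem_cons.1 hz with rfl | hz
  · exact ⟨hy, hyH⟩
  · exact h.1 z hz

/-- A product of an alternating list with at least two letters is in neither subgroup. -/
theorem IsAmalgam.prod_notMem (hA : IsAmalgam P H) {x y : Bool × A} {L : List (Bool × A)}
    (hL : IsAlternating P H (x :: y :: L)) (j : Bool) :
    ((x :: y :: L).map Prod.snd).prod ∉ P j := by
  intro hg
  obtain ⟨i, x⟩ := x
  have hx := hL.1 (i, x) List.mem_cons_self
  by_cases hij : j = i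
  · subst hij
    set g := (((j, x) :: y :: L).map Prod.snd).prod with hgdef
    rw [List.map_cons, List.prod_cons] at hgdef
    have e : g⁻¹ * x * ((y :: L).map Prod.snd).prod = 1 := by
      rw [hgdef]
      group
    by_cases hH : g⁻¹ * x ∈ H
    · refine hA _ hL.tail (List.cons_ne_nil _ _) ?_
      rw [← Subgroup.mul_mem_cancel_left _ hH, e]
      exact one_mem H
    · refine hA _ (hL.replace_head (mul_mem (inv_mem hg) hx.1) hH) (List.cons_ne_nil _ _) ?_
      rw [List.map_cons, List.prod_cons, e]
      exact one_mem H
  · refine hA _ (hL.cons hij (inv_mem hg) ?_) (List.cons_ne_nil _ _) ?_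
    · rw [inv_mem_iff]
      exact hA _ hL (List.cons_ne_nil _ _)
    · rw [List.map_cons, List.prod_cons, inv_mul_cancel]
      exact one_mem H

/-- Every element of the subgroup generated by `P true` and `P false` is the product of an element
of `H` and an alternating list. -/
theorem exists_isAlternating (hH : ∀ i, H ≤ P i) {k : A}
    (hk : k ∈ Subgroup.closure (⋃ i, (P i : Set A))) :
    ∃ h ∈ H, ∃ L, IsAlternating P H L ∧ k = h * (L.map Prod.snd).prod := by
  have step : ∀ g k : A, g ∈ (⋃ i, (P i : Set A)) →
      (∃ h ∈ H, ∃ L, IsAlternating P H L ∧ k = h * (L.map Prod.snd).prod) →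
      ∃ h ∈ H, ∃ L, IsAlternating P H L ∧ g * k = h * (L.map Prod.snd).prod := by
    rintro g _ hg ⟨h, hh, L, hL, rfl⟩
    obtain ⟨i, hg : g ∈ P i⟩ := Set.mem_iUnion.1 hg
    have hgh : g * h ∈ P i := mul_mem hg (hH i hh)
    by_cases hghH : g * h ∈ H
    · exact ⟨g * h, hghH, L, hL, (mul_assoc _ _ _).symm⟩
    rcases L with - | ⟨⟨j, x⟩, L⟩
    · refine ⟨1, one_mem H, [(i, g * h)], ⟨?_, List.isChain_singleton _⟩, by simp⟩
      simpa using ⟨hgh, hghH⟩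
    by_cases hij : i = j
    · subst hij
      by_cases hx : g * h * x ∈ H
      · exact ⟨_, hx, L, hL.tail, by simp [mul_assoc]⟩
      · exact ⟨1, one_mem H, _,
          hL.replace_head (mul_mem hgh (hL.1 (i, x) List.mem_cons_self).1) hx, by simp [mul_assoc]⟩
    · exact ⟨1, one_mem H, _, hL.cons hij hgh hghH, by simp [mul_assoc]⟩
  induction hk using Subgroup.closure_induction_left with
  | one => exact ⟨1, one_mem H, [], ⟨by simp, List.isChain_nil⟩, by simp⟩
  | mul_left g hg k _ ih => exact step g k hg ih
  | inv_mul_cancel g hg k _ ih =>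
    refine step _ k ?_ ih
    obtain ⟨i, hi⟩ := Set.mem_iUnion.1 hg
    exact Set.mem_iUnion.2 ⟨i, inv_mem hi⟩

lemma isAlternating_append_singleton_append_inv {L : List (Bool × A)} {i : Bool} {x y : A}
    (hL : IsAlternating P H (L ++ [(i, x)])) (hy : y ∈ P (!i)) (hyH : y ∉ H) :
    IsAlternating P H (L ++ [(i, x)] ++ [(!i, y)] ++
      ((L ++ [(i, x)]).map fun z => (z.1, z.2⁻¹)).reverse) := by
  refine ⟨?_, ?_⟩
  · intro z hz
    rw [List.mem_append, List.mem_append, List.mem_singleton, List.mem_reverse, List.mem_map] at hz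
    rcases hz with (hz | rfl) | ⟨u, hu, rfl⟩
    · exact hL.1 z hz
    · exact ⟨hy, hyH⟩
    · simpa using hL.1 u hu
  · have h1 := hL.2
    have h2 : (((L ++ [(i, x)]).map fun z => (z.1, z.2⁻¹)).reverse).IsChain
        fun x y => x.1 ≠ y.1 := by
      rw [List.isChain_reverse, List.isChain_map]
      exact h1.imp fun _ _ h => h.symm
    rw [List.isChain_append, List.isChain_append]
    refine ⟨⟨h1, List.isChain_singleton _, ?_⟩, h2, ?_⟩ <;> simp

/-- In an amalgamated product, if `k` conjugates an element of each of `P true \ H` and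
`P false \ H` into one of the subgroups `P j`, then `k ∈ H`. -/
theorem IsAmalgam.mem_of_conj (hA : IsAmalgam P H) (hH : ∀ i, H ≤ P i)
    {k : A} (hk : k ∈ Subgroup.closure (⋃ i, (P i : Set A))) (y : Bool → A)
    (hy : ∀ i, y i ∈ P i) (hyH : ∀ i, y i ∉ H) (hconj : ∀ i, ∃ j, k * y i * k⁻¹ ∈ P j) :
    k ∈ H := by
  obtain ⟨h, hh, L, hL, rfl⟩ := exists_isAlternating hH hk
  rcases List.eq_nil_or_concat L with rfl | ⟨L, ⟨i, x⟩, rfl⟩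
  · simpa using hh
  exfalso
  rw [List.concat_eq_append] at hL hconj
  obtain ⟨j, hj⟩ := hconj (!i)
  have hR := isAlternating_append_singleton_append_inv hL (hy (!i)) (hyH (!i))
  have hprod : ((L ++ [(i, x)] ++ [(!i, y (!i))] ++
      ((L ++ [(i, x)]).map fun z => (z.1, z.2⁻¹)).reverse).map Prod.snd).prod ∈ P j := by
    have e : ∀ L : List (Bool × A),
        (((L.map fun z => (z.1, z.2⁻¹)).reverse).map Prod.snd).prod =
          ((L.map Prod.snd).prod)⁻¹ := by
      intro L
      rw [List.prod_inv_reverse, List.map_reverse, List.map_map, List.map_map]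
      rfl
    rw [List.map_append, List.prod_append, e, List.map_append, List.prod_append]
    have h1 := mul_mem (mul_mem (inv_mem (hH j hh)) hj) (hH j hh)
    simpa [mul_assoc] using h1
  rcases L with - | ⟨z, L⟩
  · exact hA.prod_notMem hR j hprod
  · rcases L with - | ⟨z', L⟩
    · exact hA.prod_notMem hR j hprod
    · exact hA.prod_notMem hR j hprod

end Amalgam

/-! ### Artin groups with an infinite label as amalgamated products -/

namespace ArtinGroup

open Monoid

variable {B : Type*} {M : CoxeterMatrix B}

lemma isAmalgam_parabolic {a b : B} (hab : M a b = 0) :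
    IsAmalgam (fun i => parabolic M (if i then {c | c ≠ a} else {c | c ≠ b}))
      (parabolic M {c | c ≠ a ∧ c ≠ b}) := by
  classical
  set P : Bool → Subgroup (ArtinGroup M) :=
    fun i => parabolic M (if i then {c | c ≠ a} else {c | c ≠ b}) with hP
  have hH : ∀ i, parabolic M {c | c ≠ a ∧ c ≠ b} ≤ P i := by
    intro i
    refine parabolic_mono ?_
    rintro c ⟨h1, h2⟩
    cases i
    exacts [h2, h1]
  have hba : b ≠ a := by
    rintro rfl
    simp at hab
  have hgen : ∀ i c, (if i then c ≠ a else c ≠ b) → gen M c ∈ P i := by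
    intro i c h
    refine gen_mem_parabolic ?_
    cases i <;> simpa using h
  let f : B → PushoutI fun i => Subgroup.inclusion (hH i) := fun c =>
    if h : c = a then PushoutI.of false ⟨gen M c, hgen false c (by simpa [h] using hba.symm)⟩
    else PushoutI.of true ⟨gen M c, hgen true c (by simpa using h)⟩
  have hf : ∀ i c (h : if i then c ≠ a else c ≠ b), f c = PushoutI.of i ⟨gen M c, hgen i c h⟩ := by
    intro i c h
    by_cases hc : c = a
    · subst hc
      cases i
      · simp [f]
      · simp at h
    · cases i
      · have hm : gen M c ∈ parabolic M {c | c ≠ a ∧ c ≠ b} :=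
          gen_mem_parabolic ⟨hc, by simpa using h⟩
        have e := fun i => PushoutI.of_apply_eq_base (fun i => Subgroup.inclusion (hH i)) i ⟨_, hm⟩
        have h1 : f c = PushoutI.of true ⟨gen M c, hgen true c (by simpa using hc)⟩ := by
          simp [f, hc]
        exact h1.trans ((e true).trans (e false).symm)
      · simp [f, hc]
  let Ψ : ArtinGroup M →* PushoutI fun i => Subgroup.inclusion (hH i) := lift f <| by
    intro s t hst hM
    -- as `m_{a,b} = ∞`, the relation lives in one of the two subgroups
    obtain ⟨i, hs, ht⟩ : ∃ i : Bool, (if i then s ≠ a else s ≠ b) ∧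
        (if i then t ≠ a else t ≠ b) := by
      by_cases h : s ≠ a ∧ t ≠ a
      · exact ⟨true, by simpa using h⟩
      · refine ⟨false, ?_⟩
        simp only [Bool.false_eq_true, if_false]
        constructor
        · rintro rfl
          refine h ⟨hba, ?_⟩
          rintro rfl
          exact hM (by rw [M.symmetric, hab])
        · rintro rfl
          refine h ⟨?_, hba⟩
          rintro rfl
          exact hM hab
    rw [hf i s hs, hf i t ht, ← map_prodR, ← map_prodR]
    congr 1
    apply Subtype.ext
    rw [← Subgroup.coe_subtype, map_prodR, map_prodR]
    exact prodR_gen hst hM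
  refine isAmalgam_of_pushoutI hH Ψ ?_
  rintro i ⟨p, hp⟩
  have hp' := hp
  simp only [hP, parabolic] at hp'
  induction hp' using Subgroup.closure_induction with
  | mem g hg =>
    obtain ⟨c, hc, rfl⟩ := hg
    rw [lift_gen]
    exact hf i c (by cases i <;> simpa using hc)
  | one => exact (map_one Ψ).trans (map_one _).symm
  | mul g h hg hh ihg ihh =>
    exact (map_mul Ψ g h).trans ((congrArg₂ _ (ihg hg) (ihh hh)).trans (map_mul _ _ _).symm)
  | inv g hg ih => exact (map_inv Ψ g).trans ((congrArg _ (ih hg)).trans (map_inv _ _).symm)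

/-- Let `m_{a,b} = ∞`. An element that conjugates `σ_a` and `σ_b` to elements of `{σ_a, σ_b}` can
be expressed without `σ_a` and `σ_b`. -/
theorem mem_parabolic_of_conj {a b : B} (hab : M a b = 0) {k : ArtinGroup M}
    (ha : k * gen M a * k⁻¹ = gen M a ∨ k * gen M a * k⁻¹ = gen M b)
    (hb : k * gen M b * k⁻¹ = gen M a ∨ k * gen M b * k⁻¹ = gen M b) :
    k ∈ parabolic M {c | c ≠ a ∧ c ≠ b} := by
  have hba : b ≠ a := by
    rintro rfl
    simp at hab
  have hmem : ∀ c, c = a ∨ c = b →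
      ∃ i : Bool, gen M c ∈ parabolic M (if i then {c | c ≠ a} else {c | c ≠ b}) := by
    rintro c (rfl | rfl)
    · exact ⟨false, gen_mem_parabolic hba.symm⟩
    · exact ⟨true, gen_mem_parabolic hba⟩
  refine (isAmalgam_parabolic hab).mem_of_conj ?_ ?_ (fun i => gen M (if i then b else a)) ?_ ?_ ?_
  · intro i
    refine parabolic_mono ?_
    rintro c ⟨h1, h2⟩
    cases i
    exacts [h2, h1]
  · refine Subgroup.closure_mono ?_ (closure_range_gen (M := M) ▸ Subgroup.mem_top k)
    rintro _ ⟨c, rfl⟩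
    by_cases hc : c = a
    · exact Set.mem_iUnion.2 ⟨false, gen_mem_parabolic (by simpa [hc] using hba.symm)⟩
    · exact Set.mem_iUnion.2 ⟨true, gen_mem_parabolic hc⟩
  · intro i
    cases i
    exacts [gen_mem_parabolic hba.symm, gen_mem_parabolic hba]
  · intro i
    rw [gen_mem_parabolic_iff M.toCoxeterSystem]
    cases i <;> simp
  · intro i
    cases i
    · rcases ha with h | h
      · simpa [h] using hmem a (Or.inl rfl)
      · simpa [h] using hmem b (Or.inr rfl)
    · rcases hb with h | h
      · simpa [h] using hmem a (Or.inl rfl)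
      · simpa [h] using hmem b (Or.inr rfl)

end ArtinGroup

/-! ### Roots of a Coxeter system and their Coxeter matrix -/

namespace CoxeterSystem

variable {B W : Type*} [Group W] {M : CoxeterMatrix B} (cs : CoxeterSystem M W)

/-- The simple root of `s`. -/
def simpleRoot (s : B) : W × ℤˣ := (cs.simple s, 1)

/-- The set of roots of a Coxeter system: the orbit of the simple roots under the Coxeter group. A
root is encoded as a pair consisting of its reflection and its sign. -/
@[ext]
structure Root where
  /-- The reflection and the sign of the root. -/
  val : W × ℤˣ
  exists_eq : ∃ w s, val = cs.rootPerm w (cs.simpleRoot s)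

/-- The simple root of `s`, moved by `w`. -/
noncomputable def root (w : W) (s : B) : cs.Root := ⟨cs.rootPerm w (cs.simpleRoot s), w, s, rfl⟩

lemma root_val (w : W) (s : B) :
    (cs.root w s).1 = (w * cs.simple s * w⁻¹, cs.rootSign w (cs.simple s)) := by
  change cs.rootPerm w (cs.simpleRoot s) = _
  rw [rootPerm_apply, simpleRoot, mul_one]

variable {cs} in
lemma Root.exists_root (β : cs.Root) : ∃ w s, β = cs.root w s := by
  obtain ⟨β, w, s, rfl⟩ := β
  exact ⟨w, s, rfl⟩

noncomputable instance : MulAction W cs.Root where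
  smul u β := ⟨cs.rootPerm u β.1, by
    obtain ⟨β, w, s, rfl⟩ := β
    exact ⟨u * w, s, by rw [map_mul]; rfl⟩⟩
  one_smul β := Root.ext (by change cs.rootPerm 1 β.1 = _; rw [map_one]; rfl)
  mul_smul u v β := Root.ext (by
    change cs.rootPerm (u * v) β.1 = cs.rootPerm u (cs.rootPerm v β.1)
    rw [map_mul]; rfl)

@[simp] lemma smul_root (u w : W) (s : B) : u • cs.root w s = cs.root (u * w) s :=
  Root.ext (by change cs.rootPerm u (cs.rootPerm w _) = cs.rootPerm (u * w) _; rw [map_mul]; rfl)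

lemma root_one_eq_iff {w : W} {s t : B} : cs.root w s = cs.root 1 t ↔
    w * cs.simple s * w⁻¹ = cs.simple t ∧ cs.rootSign w (cs.simple s) = 1 := by
  rw [Root.ext_iff, root_val, root_val]
  simp

lemma root_injective (w : W) : Function.Injective (cs.root w) := by
  intro s t h
  rw [Root.ext_iff, root_val, root_val] at h
  exact cs.simple_injective (mul_left_cancel (mul_right_cancel (Prod.ext_iff.1 h).1))

/-- The relation between two distinct roots which form, up to the Coxeter group, a pair of simple
roots with a finite label. -/
def Linked (β γ : cs.Root) : Prop :=
  ∃ w s t, s ≠ t ∧ M s t ≠ 0 ∧ β = cs.root w s ∧ γ = cs.root w t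

variable {cs} in
lemma Linked.symm {β γ : cs.Root} (h : cs.Linked β γ) : cs.Linked γ β := by
  obtain ⟨w, s, t, hst, hM, hβ, hγ⟩ := h
  exact ⟨w, t, s, hst.symm, M.symmetric s t ▸ hM, hγ, hβ⟩

lemma linked_smul_iff (u : W) {β γ : cs.Root} : cs.Linked (u • β) (u • γ) ↔ cs.Linked β γ := by
  have key : ∀ (u : W) (β γ : cs.Root), cs.Linked β γ → cs.Linked (u • β) (u • γ) := by
    rintro u _ _ ⟨w, s, t, hst, hM, rfl, rfl⟩
    exact ⟨u * w, s, t, hst, hM, cs.smul_root u w s, cs.smul_root u w t⟩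
  refine ⟨fun h => ?_, key u β γ⟩
  simpa using key u⁻¹ _ _ h

lemma orderOf_root_mul_root {w : W} {s t : B} (hst : s ≠ t) :
    orderOf ((cs.root w s).1.1 * (cs.root w t).1.1) = M s t := by
  rw [root_val, root_val, ← cs.orderOf_simple_mul_simple hst]
  have e : w * cs.simple s * w⁻¹ * (w * cs.simple t * w⁻¹) =
      MulAut.conj w (cs.simple s * cs.simple t) := by
    rw [MulAut.conj_apply]
    group
  rw [e]
  exact orderOf_injective (MulAut.conj w).toMonoidHom (MulAut.conj w).injective _

open scoped Classical in
/-- The Coxeter matrix on the set of roots which describes the kernel of the projection of the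
virtual Artin group to the Coxeter group sending each `σ_s` to `1`. Linked roots `w α_s` and `w α_t`
get the label `m_{s,t}`, which is the order of the product of their reflections, and other pairs of
distinct roots the label `∞`, encoded as `0`. -/
noncomputable def rootMatrix : CoxeterMatrix cs.Root where
  M β γ := if β = γ then 1 else if cs.Linked β γ then orderOf (β.1.1 * γ.1.1) else 0
  isSymm := by
    refine Matrix.IsSymm.ext fun γ β => ?_
    by_cases h : β = γ
    · subst h
      rfl
    have h' : γ ≠ β := Ne.symm h
    by_cases hl : cs.Linked β γ
    · obtain ⟨w, s, t, hst, hM, rfl, rfl⟩ := hl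
      have hl : cs.Linked (cs.root w s) (cs.root w t) := ⟨w, s, t, hst, hM, rfl, rfl⟩
      rw [if_neg h, if_neg h', if_pos hl, if_pos hl.symm, cs.orderOf_root_mul_root hst,
        cs.orderOf_root_mul_root hst.symm, M.symmetric]
    · rw [if_neg h, if_neg h', if_neg hl, if_neg (mt Linked.symm hl)]
  diagonal β := if_pos rfl
  off_diagonal β γ h := by
    rw [if_neg h]
    by_cases hl : cs.Linked β γ
    · obtain ⟨w, s, t, hst, hM, rfl, rfl⟩ := hl
      rw [if_pos ⟨w, s, t, hst, hM, rfl, rfl⟩, cs.orderOf_root_mul_root hst]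
      exact M.off_diagonal s t hst
    · rw [if_neg hl]
      exact zero_ne_one

lemma rootMatrix_root (w : W) {s t : B} (hst : s ≠ t) :
    cs.rootMatrix (cs.root w s) (cs.root w t) = M s t := by
  classical
  have hne : cs.root w s ≠ cs.root w t := fun h => hst (cs.root_injective w h)
  by_cases hl : cs.Linked (cs.root w s) (cs.root w t)
  · exact (if_neg hne).trans ((if_pos hl).trans (cs.orderOf_root_mul_root hst))
  · refine (if_neg hne).trans ((if_neg hl).trans ?_)
    by_contra hM
    exact hl ⟨w, s, t, hst, Ne.symm hM, rfl, rfl⟩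

lemma linked_of_rootMatrix_ne_zero {β γ : cs.Root} (h : β ≠ γ) (hM : cs.rootMatrix β γ ≠ 0) :
    cs.Linked β γ := by
  classical
  by_contra hl
  exact hM ((if_neg h).trans (if_neg hl))

lemma rootMatrix_smul (u : W) (β γ : cs.Root) :
    cs.rootMatrix (u • β) (u • γ) = cs.rootMatrix β γ := by
  classical
  by_cases h : β = γ
  · subst h
    rw [cs.rootMatrix.diagonal, cs.rootMatrix.diagonal]
  by_cases hl : cs.Linked β γ
  · obtain ⟨w, s, t, hst, hM, rfl, rfl⟩ := hl
    rw [smul_root, smul_root, cs.rootMatrix_root _ hst, cs.rootMatrix_root _ hst]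
  · rw [not_imp_comm.1 (cs.linked_of_rootMatrix_ne_zero h) hl, not_imp_comm.1
      (cs.linked_of_rootMatrix_ne_zero (mt (MulAction.injective u ·) h))
      (mt (cs.linked_smul_iff u).1 hl)]

end CoxeterSystem

/-! ### Virtual Artin groups -/

lemma prodR_of_even_odd {G : Type*} [Monoid G] (b a : G) (k : ℕ) :
    prodR b a (2 * k) = (b * a) ^ k ∧ prodR b a (2 * k + 1) = a * (b * a) ^ k := by
  induction k with
  | zero => simp [prodR]
  | succ k ih =>
    have e : prodR b a (2 * (k + 1)) = prodR b a (2 * k) * b * a := rfl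
    have e' : prodR b a (2 * (k + 1) + 1) = prodR b a (2 * k + 1) * b * a := rfl
    rw [e, e', ih.1, ih.2, pow_succ]
    simp only [mul_assoc, and_self]

/-- For involutions, the braid relation implies the relation of the Coxeter presentation. -/
lemma mul_pow_eq_one_of_prodR_eq {G : Type*} [Group G] {a b : G} (ha : a * a = 1) (hb : b * b = 1)
    {n : ℕ} (h : prodR b a n = prodR a b n) : (a * b) ^ n = 1 := by
  have hinv : b * a = (a * b)⁻¹ := by
    rw [mul_inv_rev, inv_eq_of_mul_eq_one_left ha, inv_eq_of_mul_eq_one_left hb]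
  obtain ⟨k, rfl | rfl⟩ := n.even_or_odd'
  · rw [(prodR_of_even_odd b a k).1, (prodR_of_even_odd a b k).1, hinv, inv_pow,
      inv_eq_iff_mul_eq_one, ← pow_add, ← two_mul] at h
    exact h
  · rw [(prodR_of_even_odd b a k).2, (prodR_of_even_odd a b k).2, hinv, inv_pow,
      mul_inv_eq_iff_eq_mul, mul_assoc, ← pow_add, ← two_mul, ← mul_right_inj a, ha, ← mul_assoc,
      ← pow_succ'] at h
    exact h.symm

namespace VirtualArtinGroup

variable {S : Type*} {M : CoxeterMatrix S}

/-- The generator `σ_s` of the virtual Artin group. -/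
def sigma (M : CoxeterMatrix S) (s : S) : VirtualArtinGroup M := PresentedGroup.of (VAGen.sigma s)

/-- The generator `τ_s` of the virtual Artin group. -/
def tau (M : CoxeterMatrix S) (s : S) : VirtualArtinGroup M := PresentedGroup.of (VAGen.tau s)

lemma mk_eq_mk_of_rel {x y : FreeGroup (VAGen S)} (h : VARel M x y) :
    PresentedGroup.mk {g : FreeGroup (VAGen S) | ∃ x y, VARel M x y ∧ g = x * y⁻¹} x =
      PresentedGroup.mk _ y :=
  PresentedGroup.mk_eq_mk_of_mul_inv_mem ⟨x, y, h, rfl⟩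

lemma prodR_sigma {s t : S} (hst : s ≠ t) (hM : M s t ≠ 0) :
    prodR (sigma M t) (sigma M s) (M s t) = prodR (sigma M s) (sigma M t) (M s t) := by
  have h := mk_eq_mk_of_rel (VARel.artin s t hst hM)
  rwa [map_prodR, map_prodR] at h

lemma prodR_tau {s t : S} (hst : s ≠ t) (hM : M s t ≠ 0) :
    prodR (tau M t) (tau M s) (M s t) = prodR (tau M s) (tau M t) (M s t) := by
  have h := mk_eq_mk_of_rel (VARel.coxeter s t hst hM)
  rwa [map_prodR, map_prodR] at h

lemma tau_mul_tau (s : S) : tau M s * tau M s = 1 := by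
  have h := mk_eq_mk_of_rel (VARel.involution (M := M) s)
  rwa [map_pow, map_one, pow_two] at h

lemma prodR_tau_mul_sigma {s t : S} (hst : s ≠ t) (hM : M s t ≠ 0) :
    prodR (tau M s) (tau M t) (M s t - 1) * sigma M s =
      sigma M (if Even (M s t) then s else t) * prodR (tau M s) (tau M t) (M s t - 1) := by
  split_ifs with he
  · have h := mk_eq_mk_of_rel (VARel.mixed_even s t hst hM he)
    rwa [map_mul, map_mul, map_prodR] at h
  · have h := mk_eq_mk_of_rel (VARel.mixed_odd s t hst hM (Nat.not_even_iff_odd.1 he))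
    rwa [map_mul, map_mul, map_prodR] at h

lemma hom_ext {G : Type*} [Monoid G] {f g : VirtualArtinGroup M →* G}
    (hσ : ∀ s, f (sigma M s) = g (sigma M s)) (hτ : ∀ s, f (tau M s) = g (tau M s)) : f = g :=
  MonoidHom.eq_of_eqOn_dense (PresentedGroup.closure_range_of _) <| by
    rintro _ ⟨s | s, rfl⟩
    exacts [hσ s, hτ s]

/-- The homomorphism from a virtual Artin group defined by images of the generators. -/
def lift {G : Type*} [Group G] (f g : S → G)
    (hf : ∀ s t, s ≠ t → M s t ≠ 0 → prodR (f t) (f s) (M s t) = prodR (f s) (f t) (M s t))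
    (hg : ∀ s t, s ≠ t → M s t ≠ 0 → prodR (g t) (g s) (M s t) = prodR (g s) (g t) (M s t))
    (hg2 : ∀ s, g s * g s = 1)
    (hfg : ∀ s t, s ≠ t → M s t ≠ 0 → prodR (g s) (g t) (M s t - 1) * f s =
      f (if Even (M s t) then s else t) * prodR (g s) (g t) (M s t - 1)) :
    VirtualArtinGroup M →* G :=
  PresentedGroup.toGroup (f := fun x => match x with
    | VAGen.sigma s => f s
    | VAGen.tau s => g s) <| by
    rintro _ ⟨x, y, h, rfl⟩
    rw [map_mul, map_inv, mul_inv_eq_one]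
    cases h with
    | artin s t hst hM => simpa [map_prodR, freeSigma] using hf s t hst hM
    | coxeter s t hst hM => simpa [map_prodR, freeTau] using hg s t hst hM
    | involution s => simpa [freeTau, pow_two] using hg2 s
    | mixed_even s t hst hM he =>
      simpa [map_prodR, freeTau, freeSigma, he] using hfg s t hst hM
    | mixed_odd s t hst hM ho =>
      simpa [map_prodR, freeTau, freeSigma, Nat.not_even_iff_odd.2 ho] using hfg s t hst hM

section
variable {G : Type*} [Group G] (f g : S → G) (hf) (hg) (hg2) (hfg)

@[simp] lemma lift_sigma (s : S) : lift (M := M) f g hf hg hg2 hfg (sigma M s) = f s :=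
  PresentedGroup.toGroup.of _

@[simp] lemma lift_tau (s : S) : lift (M := M) f g hf hg hg2 hfg (tau M s) = g s :=
  PresentedGroup.toGroup.of _

end

variable {W : Type*} [Group W] (cs : CoxeterSystem M W)

lemma isLiftable_tau : M.IsLiftable (tau M) := by
  intro s t
  rcases eq_or_ne s t with rfl | hst
  · simp [tau_mul_tau]
  · by_cases hM : M s t = 0
    · rw [hM, pow_zero]
    · exact mul_pow_eq_one_of_prodR_eq (tau_mul_tau s) (tau_mul_tau t) (prodR_tau hst hM)

/-- The section of the projection to the Coxeter group that maps `s` to `τ_s`. -/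
noncomputable def ofCoxeter : W →* VirtualArtinGroup M := cs.lift ⟨tau M, isLiftable_tau⟩

@[simp] lemma ofCoxeter_simple (s : S) : ofCoxeter cs (cs.simple s) = tau M s :=
  cs.lift_apply_simple _ s

/-- If `w` maps the simple root of `s` to that of `t`, then it conjugates `σ_s` to `σ_t`. If `w` is
nontrivial, it can be written as `d * v`, where `v` is a nontrivial element of a dihedral parabolic
subgroup containing `s`, and `d` is shorter than `w` and dominant for this subgroup. Then `v` maps
the simple root of `s` to a simple root, so it is the element in a mixed relation. -/
theorem ofCoxeter_conj_sigma (w : W) : ∀ {s t : S}, w * cs.simple s * w⁻¹ = cs.simple t →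
    cs.rootSign w (cs.simple s) = 1 →
    ofCoxeter cs w * sigma M s * (ofCoxeter cs w)⁻¹ = sigma M t := by
  induction hn : cs.length w using Nat.strong_induction_on generalizing w with
  | h n ih =>
  subst hn
  intro s t hst hs
  by_cases hw : w = 1
  · subst hw
    have : s = t := cs.simple_injective (by simpa using hst)
    simp [this]
  obtain ⟨r, hr⟩ := cs.exists_rootSign_simple hw
  have hrs : r ≠ s := by
    rintro rfl
    exact absurd (hs.symm.trans hr) (by decide)
  have hrm : cs.simple r ∈ cs.parabolic {r, s} := cs.simple_mem_parabolic (by simp)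
  have hsm : cs.simple s ∈ cs.parabolic {r, s} := cs.simple_mem_parabolic (by simp)
  obtain ⟨d, v, hv, rfl, hmin⟩ := cs.exists_minimal_mul (cs.parabolic {r, s}) w
  have hd : ∀ u ∈ cs.parabolic {r, s}, cs.rootSign d u = 1 := by
    intro u hu
    by_contra hne
    exact absurd (cs.length_mul_lt_of_rootSign (cs.rootSign_ne_one.1 hne)) (hmin u hu).not_gt
  have hdv : cs.length d < cs.length (d * v) := by
    have h1 := cs.length_mul_lt_of_rootSign hr
    have h2 := hmin _ (mul_mem hv hrm)
    rw [← mul_assoc] at h2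
    exact h2.trans_lt h1
  rw [CoxeterSystem.rootSign_mul, hd _ (mul_mem (mul_mem hv hrm) (inv_mem hv)), one_mul] at hr
  have hvsv : v * cs.simple s * v⁻¹ ∈ cs.parabolic {r, s} :=
    mul_mem (mul_mem hv hsm) (inv_mem hv)
  rw [CoxeterSystem.rootSign_mul, hd _ hvsv, one_mul] at hs
  have hst' : d * (v * cs.simple s * v⁻¹) * d⁻¹ = cs.simple t := by
    rw [← hst]
    group
  -- `v` is an alternating product ending in `r`, of length less than `m_{r,s}`
  obtain ⟨n, hnM, rfl⟩ : ∃ n, (M r s ≠ 0 → n + 1 < M r s) ∧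
      v = prodR (cs.simple s) (cs.simple r) (n + 1) := by
    obtain ⟨n, hn, rfl | rfl⟩ := cs.exists_eq_prodR hrs hv
    · rcases n with - | n
      · simp [prodR] at hr
      · refine ⟨n, fun hM => lt_of_le_of_ne (hn hM) fun e => ?_, rfl⟩
        rw [cs.rootSign_prodR hrs, e, Nat.div_self (Nat.pos_of_ne_zero hM)] at hs
        exact absurd hs (by decide)
    · rcases n with - | n
      · simp [prodR] at hr
      · have h0 : n / M s r = 0 := by
          rw [M.symmetric s r]
          by_cases hM : M r s = 0
          · rw [hM, Nat.div_zero]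
          · exact Nat.div_eq_of_lt (hn hM)
        rw [cs.rootSign_prodR_succ hrs.symm, h0] at hs
        exact absurd hs (by decide)
  obtain ⟨c, hc, hcv⟩ := cs.exists_eq_simple_of_conj_eq_simple hd hvsv hst'
  have hne : ¬ M r s ∣ n + 1 := by
    intro h
    by_cases hM : M r s = 0
    · rw [hM, zero_dvd_iff] at h
      omega
    · exact absurd (Nat.le_of_dvd (Nat.succ_pos n) h) (hnM hM).not_ge
  have hc' : c = if Even (n + 1) then r else s := by
    by_contra hcne
    have hcn : c = if Even n then r else s := by
      rcases hc with rfl | rfl <;> by_cases he : Even n <;> simp_all [Nat.even_add_one]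
    refine hne ((cs.prodR_conj_eq_iff hrs n).1 ?_)
    rw [prodR_succ', ← apply_ite cs.simple, ← hcn] at hcv
    rw [← hcn, ← mul_right_inj (cs.simple c), ← mul_left_inj (cs.simple c)⁻¹, mul_inv_cancel_right]
    refine Eq.trans ?_ hcv
    group
  have hcv' := hcv
  rw [hc', cs.prodR_conj_eq_iff hrs] at hcv'
  have hM : M r s ≠ 0 := by
    intro h
    rw [h, zero_dvd_iff] at hcv'
    omega
  have hnM' : M s r = n + 1 + 1 := by
    have h1 := Nat.le_of_dvd (by omega) hcv'
    have h2 := hnM hM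
    rw [M.symmetric s r]
    omega
  have hmixed := prodR_tau_mul_sigma hrs.symm (M.symmetric s r ▸ hM)
  have hcs : (if Even (n + 1 + 1) then s else r) = c := by
    rw [hc']
    by_cases he : Even n <;> simp [he, parity_simps]
  rw [hnM', hcs, Nat.add_sub_cancel, ← mul_inv_eq_iff_eq_mul, ← ofCoxeter_simple cs,
    ← ofCoxeter_simple cs, ← map_prodR] at hmixed
  rw [hcv] at hst'
  have hdc := hd (cs.simple c) (hcv ▸ hvsv)
  rw [← ih _ hdv d rfl hst' hdc, ← hmixed, map_mul]
  group

/-! ### The virtual Artin group as a semidirect product -/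

/-- The action of an element of the Coxeter group on the Artin group of its root matrix. -/
noncomputable def rootAction (w : W) : ArtinGroup cs.rootMatrix →* ArtinGroup cs.rootMatrix :=
  ArtinGroup.lift (fun β => ArtinGroup.gen _ (w • β)) fun β γ h hM => by
    rw [← cs.rootMatrix_smul w] at hM ⊢
    exact ArtinGroup.prodR_gen (mt (MulAction.injective w ·) h) hM

@[simp] lemma rootAction_gen (w : W) (β : cs.Root) :
    rootAction cs w (ArtinGroup.gen _ β) = ArtinGroup.gen _ (w • β) :=
  ArtinGroup.lift_gen _ _ _

lemma rootAction_mul (w v : W) :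
    rootAction cs (w * v) = (rootAction cs w).comp (rootAction cs v) :=
  ArtinGroup.hom_ext fun β => by simp [mul_smul]

lemma rootAction_one : rootAction cs 1 = MonoidHom.id _ :=
  ArtinGroup.hom_ext fun β => by simp

/-- The action of the Coxeter group on the Artin group of its root matrix, permuting the
generators. -/
noncomputable def rootAut : W →* MulAut (ArtinGroup cs.rootMatrix) where
  toFun w := MonoidHom.toMulEquiv (rootAction cs w) (rootAction cs w⁻¹)
    (by rw [← rootAction_mul, inv_mul_cancel, rootAction_one])
    (by rw [← rootAction_mul, mul_inv_cancel, rootAction_one])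
  map_one' := by
    ext x
    exact DFunLike.congr_fun (rootAction_one cs) x
  map_mul' w v := by
    ext x
    exact DFunLike.congr_fun (rootAction_mul cs w v) x

@[simp] lemma rootAut_gen (w : W) (β : cs.Root) :
    rootAut cs w (ArtinGroup.gen _ β) = ArtinGroup.gen _ (w • β) :=
  rootAction_gen cs w β

lemma root_prodR {s t : S} (hst : s ≠ t) (hM : M s t ≠ 0) :
    cs.root (prodR (cs.simple s) (cs.simple t) (M s t - 1)) s =
      cs.root 1 (if Even (M s t) then s else t) := by
  obtain ⟨m, hm⟩ := Nat.exists_eq_succ_of_ne_zero hM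
  have hts : M t s = m + 1 := by rw [M.symmetric, hm]
  rw [CoxeterSystem.root_one_eq_iff, hm, Nat.succ_eq_add_one, Nat.add_sub_cancel,
    cs.rootSign_prodR hst.symm, hts, Nat.div_eq_of_lt (Nat.lt_succ_self m), pow_zero]
  refine ⟨?_, rfl⟩
  rw [(cs.prodR_conj_eq_iff hst.symm m).2 (by rw [hts])]
  congr 1
  by_cases he : Even m <;> simp [he, parity_simps]

open SemidirectProduct in
/-- The homomorphism from the virtual Artin group to the semidirect product of the Artin group of
the root matrix and the Coxeter group, sending `σ_s` to the generator of the simple root of `s`. -/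
noncomputable def toSemidirect :
    VirtualArtinGroup M →* ArtinGroup cs.rootMatrix ⋊[rootAut cs] W :=
  lift (fun s => inl (ArtinGroup.gen _ (cs.root 1 s))) (fun s => inr (cs.simple s))
    (fun s t hst hM => by
      rw [← map_prodR, ← map_prodR, ← cs.rootMatrix_root 1 hst]
      rw [← cs.rootMatrix_root 1 hst] at hM
      rw [ArtinGroup.prodR_gen (fun h => hst (cs.root_injective 1 h)) hM])
    (fun s t hst _ => by
      rw [← map_prodR, ← map_prodR, (cs.prodR_eq_prodR_iff hst _).2 dvd_rfl])
    (fun s => by rw [← map_mul, cs.simple_mul_simple_self, map_one])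
    (fun s t hst hM => by
      rw [← map_prodR, ← mul_inv_eq_iff_eq_mul, ← map_inv, ← inl_aut, rootAut_gen,
        CoxeterSystem.smul_root, mul_one, root_prodR cs hst hM])

@[simp] lemma toSemidirect_sigma (s : S) : toSemidirect cs (sigma M s) =
    SemidirectProduct.inl (ArtinGroup.gen _ (cs.root 1 s)) := lift_sigma _ _ _ _ _ _ s

@[simp] lemma toSemidirect_tau (s : S) : toSemidirect cs (tau M s) =
    SemidirectProduct.inr (cs.simple s) := lift_tau _ _ _ _ _ _ s

/-- The element `w σ_s w⁻¹` of the virtual Artin group attached to the root `w α_s`. -/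
noncomputable def rootGen (β : cs.Root) : VirtualArtinGroup M :=
  ofCoxeter cs β.exists_root.choose * sigma M β.exists_root.choose_spec.choose *
    (ofCoxeter cs β.exists_root.choose)⁻¹

lemma rootGen_root (w : W) (s : S) :
    rootGen cs (cs.root w s) = ofCoxeter cs w * sigma M s * (ofCoxeter cs w)⁻¹ := by
  have h := (cs.root w s).exists_root.choose_spec.choose_spec
  rw [rootGen]
  generalize (cs.root w s).exists_root.choose_spec.choose = t at h ⊢
  generalize (cs.root w s).exists_root.choose = v at h ⊢
  have h' := congrArg (v⁻¹ • ·) h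
  simp only [CoxeterSystem.smul_root, inv_mul_cancel, CoxeterSystem.root_one_eq_iff] at h'
  rw [← ofCoxeter_conj_sigma cs _ h'.1 h'.2, map_mul, map_inv]
  group

lemma rootGen_smul (w : W) (β : cs.Root) :
    rootGen cs (w • β) = ofCoxeter cs w * rootGen cs β * (ofCoxeter cs w)⁻¹ := by
  obtain ⟨v, s, rfl⟩ := β.exists_root
  rw [CoxeterSystem.smul_root, rootGen_root, rootGen_root, map_mul]
  group

/-- The homomorphism from the Artin group of the root matrix to the virtual Artin group. -/
noncomputable def ofArtin : ArtinGroup cs.rootMatrix →* VirtualArtinGroup M :=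
  ArtinGroup.lift (rootGen cs) fun β γ h hM => by
    obtain ⟨w, s, t, hst, -, rfl, rfl⟩ := cs.linked_of_rootMatrix_ne_zero h hM
    rw [cs.rootMatrix_root w hst] at hM ⊢
    rw [rootGen_root, rootGen_root, ← MulAut.conj_apply, ← MulAut.conj_apply, ← map_prodR,
      ← map_prodR, prodR_sigma hst hM]

@[simp] lemma ofArtin_gen (β : cs.Root) : ofArtin cs (ArtinGroup.gen _ β) = rootGen cs β :=
  ArtinGroup.lift_gen _ _ _

/-- The inverse of `toSemidirect`. -/
noncomputable def ofSemidirect :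
    ArtinGroup cs.rootMatrix ⋊[rootAut cs] W →* VirtualArtinGroup M :=
  SemidirectProduct.lift (ofArtin cs) (ofCoxeter cs) fun w =>
    ArtinGroup.hom_ext fun β => by
      simp [rootGen_smul]

lemma ofSemidirect_toSemidirect (g : VirtualArtinGroup M) :
    ofSemidirect cs (toSemidirect cs g) = g := by
  have : (ofSemidirect cs).comp (toSemidirect cs) = MonoidHom.id _ :=
    hom_ext (fun s => by simp [ofSemidirect, rootGen_root]) (fun s => by simp [ofSemidirect])
  exact DFunLike.congr_fun this g

lemma toSemidirect_ofCoxeter (w : W) :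
    toSemidirect cs (ofCoxeter cs w) = SemidirectProduct.inr w := by
  have : (toSemidirect cs).comp (ofCoxeter cs) = SemidirectProduct.inr :=
    cs.ext_simple fun s => by simp
  exact DFunLike.congr_fun this w

lemma toSemidirect_ofSemidirect (x : ArtinGroup cs.rootMatrix ⋊[rootAut cs] W) :
    toSemidirect cs (ofSemidirect cs x) = x := by
  have : (toSemidirect cs).comp (ofSemidirect cs) = MonoidHom.id _ := by
    refine SemidirectProduct.hom_ext (ArtinGroup.hom_ext fun β => ?_) (MonoidHom.ext fun w => ?_)
    · obtain ⟨w, s, rfl⟩ := β.exists_root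
      simp [ofSemidirect, rootGen_root, toSemidirect_ofCoxeter, ← map_inv,
        ← SemidirectProduct.inl_aut]
    · simp [ofSemidirect, toSemidirect_ofCoxeter]
  exact DFunLike.congr_fun this x

/-- A virtual Artin group is the semidirect product of the Artin group of the root matrix and the
Coxeter group. -/
noncomputable def semidirectEquiv :
    VirtualArtinGroup M ≃* ArtinGroup cs.rootMatrix ⋊[rootAut cs] W where
  toFun := toSemidirect cs
  invFun := ofSemidirect cs
  left_inv := ofSemidirect_toSemidirect cs
  right_inv := toSemidirect_ofSemidirect cs
  map_mul' := map_mul _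

/-- A root and its opposite have label `∞`. -/
lemma rootMatrix_root_neg (w : W) (s : S) :
    cs.rootMatrix (cs.root w s) (cs.root (w * cs.simple s) s) = 0 := by
  by_contra hM
  have hne : cs.root w s ≠ cs.root (w * cs.simple s) s := by
    intro h
    have h' := congrArg (w⁻¹ • ·) h.symm
    simp [CoxeterSystem.root_one_eq_iff, cs.rootSign_simple_self] at h'
  obtain ⟨v, a, b, hab, -, h1, h2⟩ := cs.linked_of_rootMatrix_ne_zero hne hM
  have e1 := congrArg (fun β => β.1.1) h1
  have e2 := congrArg (fun β => β.1.1) h2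
  simp only [CoxeterSystem.root_val] at e1 e2
  have e3 : w * cs.simple s * cs.simple s * (w * cs.simple s)⁻¹ = w * cs.simple s * w⁻¹ := by
    simp [mul_assoc]
  rw [e3, e1] at e2
  exact hab (cs.simple_injective (mul_left_cancel (mul_right_cancel e2)))

/-- The center of the semidirect product is trivial. If `(k, w)` is central, then `w` is central in
the Coxeter group, so it maps each root `β` to `β` or `-β`, and `k` conjugates the generators of
these two roots to each other or centralizes them. As the label of `β` and `-β` is `∞`, the element
`k` can be expressed without the generator of `β`. -/
theorem center_semidirect :
    Subgroup.center (ArtinGroup cs.rootMatrix ⋊[rootAut cs] W) = ⊥ := by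
  rw [eq_bot_iff]
  rintro ⟨k, w⟩ h
  rw [Subgroup.mem_center_iff] at h
  have hw : ∀ u, u * w = w * u := fun u =>
    congrArg SemidirectProduct.right (h (SemidirectProduct.inr u))
  have hk : ∀ β, ArtinGroup.gen _ β * k = k * ArtinGroup.gen _ (w • β) := by
    intro β
    have := congrArg SemidirectProduct.left (h (SemidirectProduct.inl (ArtinGroup.gen _ β)))
    simpa using this
  have hroot : ∀ s, (∀ u, w • cs.root u s = cs.root u s) ∨
      ∀ u, w • cs.root u s = cs.root (u * cs.simple s) s := by
    intro s
    have e : w * cs.simple s * w⁻¹ = cs.simple s := by rw [← hw, mul_inv_cancel_right]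
    have e' : ∀ u, w • cs.root u s = u • cs.root w s := fun u => by
      rw [cs.smul_root, cs.smul_root, hw]
    rcases Int.units_eq_one_or (cs.rootSign w (cs.simple s)) with h1 | h1
    · left
      intro u
      rw [e', (cs.root_one_eq_iff).2 ⟨e, h1⟩, cs.smul_root, mul_one]
    · right
      intro u
      have : cs.root w s = cs.root (cs.simple s) s := by
        rw [CoxeterSystem.Root.ext_iff, cs.root_val, cs.root_val, e, h1, cs.rootSign_simple_self,
          mul_inv_cancel_right]
      rw [e', this, cs.smul_root]
  have hk1 : k = 1 := by
    refine ArtinGroup.eq_one_of_forall_mem_parabolic fun β => ?_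
    obtain ⟨u, s, rfl⟩ := β.exists_root
    have hconj : ∀ β, k * ArtinGroup.gen _ (w • β) * k⁻¹ = ArtinGroup.gen _ β := fun β => by
      rw [← hk, mul_inv_cancel_right]
    have h2 := hconj (cs.root u s)
    have h3 := hconj (cs.root (u * cs.simple s) s)
    have hmem : k ∈ ArtinGroup.parabolic cs.rootMatrix
        {c | c ≠ cs.root u s ∧ c ≠ cs.root (u * cs.simple s) s} := by
      refine ArtinGroup.mem_parabolic_of_conj (rootMatrix_root_neg cs u s) ?_ ?_
      · rcases hroot s with h1 | h1
        · exact Or.inl (by rwa [h1] at h2)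
        · exact Or.inr (by rwa [h1, CoxeterSystem.simple_mul_simple_cancel_right] at h3)
      · rcases hroot s with h1 | h1
        · exact Or.inr (by rwa [h1] at h3)
        · exact Or.inl (by rwa [h1] at h2)
    exact ArtinGroup.parabolic_mono (fun c hc => hc.1) hmem
  subst hk1
  have hw1 : w = 1 := by
    by_contra hne
    obtain ⟨s, hs⟩ := cs.exists_rootSign_simple hne
    have h1 := hk (cs.root 1 s)
    rw [mul_one, one_mul] at h1
    have h2 := ArtinGroup.gen_injective cs.rootMatrix.toCoxeterSystem h1
    rw [cs.smul_root, mul_one, eq_comm, cs.root_one_eq_iff, hs] at h2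
    exact absurd h2.2 (by decide)
  subst hw1
  exact Subgroup.mem_bot.2 rfl

end VirtualArtinGroup

theorem corollary3p4 {S : Type*} [Countable S] (M : CoxeterMatrix S) :
    Subgroup.center (VirtualArtinGroup M) = ⊥ := by
  let e := VirtualArtinGroup.semidirectEquiv M.toCoxeterSystem
  rw [eq_bot_iff]
  intro z hz
  have h : e z ∈ Subgroup.center _ := by
    rw [Subgroup.mem_center_iff] at hz ⊢
    intro x
    obtain ⟨y, rfl⟩ := e.surjective x
    rw [← map_mul, ← map_mul, hz y]
  rw [VirtualArtinGroup.center_semidirect, Subgroup.mem_bot, map_eq_one_iff e e.injective] at h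
  exact Subgroup.mem_bot.2 h
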